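/- Let $0<a<b<1$, $t_0<t_1$, $a_0\in\mathbb{R}$, $K>0$, and let $\alpha:\mathbb{R}\to[a,b]$ be continuously differentiable with bounded derivative. Write $r^{\langle s\rangle}=\operatorname{sign}(r)|r|^{s}$, $$|y|^{-1/(a,b)}=\max\big\{|y|^{-1/a}(1+|\log|y||),\ |y|^{-1/b}(1+|\log|y||)\big\},\qquad M=\sup_{\xi\in\mathbb{R}}\frac{|\alpha'(\xi)|}{\alpha(\xi)^2}.$$ Let $D[t_0,t_1)$ be the set of functions on $[t_0,t_1)$ that are right continuous and have left limits at all points of $(t_0,t_1]$, and let $\|f\|_\infty=\sup_{t_0\le t<t_1}|f(t)|$. Let $\Pi$ be a Poisson point process on $(t_0,t_1)\times\big((-\infty,-K]\cup[K,\infty)\big)$ with plane Lebesgue measure as mean measure. Then, almost surely, there is a unique $f\in D[t_0,t_1)$ with $$f(t)=a_0+\sum_{(x,y)\in\Pi}1_{(t_0,t]}(x)\,y^{\langle-1/\alpha(f(x_-))\rangle}\qquad(t_0\le t<t_1),$$ and the same holds for each $n\in\mathbb{N}$ when the sum is restricted to the points of $\Pi$ with $|y|\le n$. Let $Z$ and $Z_n$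 ($n\ge1$) be stochastic processes whose sample paths are, almost surely, in $D[t_0,t_1)$ and satisfy $$Z(t)=a_0+\sum_{(x,y)\in\Pi}1_{(t_0,t]}(x)\,y^{\langle-1/\alpha(Z(x_-))\rangle},\qquad Z_n(t)=a_0+\sum_{(x,y)\in\Pi:\,|y|\le n}1_{(t_0,t]}(x)\,y^{\langle-1/\alpha(Z_n(x_-))\rangle}\qquad(t_0\le t<t_1).$$ Then $\int_K^\infty y^{-1/(a,b)}\,dy<\infty$, $\mathbb{E}\|Z_n-Z\|_\infty\to0$ as $n\to\infty$, and for every integer $n\ge1$ $$\mathbb{E}\|Z_n-Z\|_\infty\ \le\ \frac{2b(t_1-t_0)}{1-b}\exp\Big(2M(t_1-t_0)\int_K^\infty y^{-1/(a,b)}\,dy\Big)\,n^{-(1-b)/b}.$$ -/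

import Mathlib

open Set Filter Topology MeasureTheory ProbabilityTheory
open scoped ENNReal

noncomputable section

namespace SelfStabilizing

/-- `signedPow r s` is `sign(r) |r| ^ s`. -/
def signedPow (r s : ℝ) : ℝ := Real.sign r * |r| ^ s

/-- The function `y ↦ |y|^{-1/(a,b)}`, that is
`max (|y|^{-1/a} (1 + |log |y||)) (|y|^{-1/b} (1 + |log |y||))`. -/
def absPowAB (a b y : ℝ) : ℝ :=
  max (|y| ^ (-1 / a) * (1 + abs (Real.log |y|))) (|y| ^ (-1 / b) * (1 + abs (Real.log |y|)))

/-- The constant `M = sup_ξ |α'(ξ)| / α(ξ)^2`. -/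
def lipConst (α : ℝ → ℝ) : ℝ := ⨆ ξ : ℝ, |deriv α ξ| / α ξ ^ 2

/-- The space `D[t₀, t₁)`: right continuous at every `u ∈ [t₀, t₁)`, with a left limit at every
`u ∈ (t₀, t₁]` (the left limit at `t₁` included). Values outside `[t₀, t₁)` play no role. -/
def IsCadlag (t₀ t₁ : ℝ) (f : ℝ → ℝ) : Prop :=
  (∀ u ∈ Ico t₀ t₁, Tendsto f (𝓝[>] u) (𝓝 (f u))) ∧
    ∀ u ∈ Ioc t₀ t₁, ∃ l : ℝ, Tendsto f (𝓝[<] u) (𝓝 l)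

/-- `f ∈ D[t₀, t₁)` satisfies
`f(t) = a₀ + ∑_{(x,y) ∈ S} 1_{(t₀,t]}(x) y^{⟨-1/α(f(x-))⟩}` for all `t ∈ [t₀, t₁)`,
the sum being absolutely convergent. -/
def IsJumpPath (t₀ t₁ a₀ : ℝ) (α : ℝ → ℝ) (S : Set (ℝ × ℝ)) (f : ℝ → ℝ) : Prop :=
  IsCadlag t₀ t₁ f ∧
    ∀ t ∈ Ico t₀ t₁,
      HasSum
        (fun p : S => (Ioc t₀ t).indicator
          (fun x => signedPow p.1.2 (-1 / α (Function.leftLim f x))) p.1.1)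
        (f t - a₀)

/-- The supremum distance `‖f - g‖_∞` on `[t₀, t₁)`, with values in `[0, ∞]`. -/
def supDist (t₀ t₁ : ℝ) (f g : ℝ → ℝ) : ℝ≥0∞ :=
  ⨆ t : Ico t₀ t₁, ENNReal.ofReal |f t - g t|

/-- `Pt` is a Poisson point process with mean measure `μ` on the probability space `(Ω, P)`:
the number `N(A)` of points in a measurable set `A` is a random variable that has the Poisson
distribution with mean `μ(A)` (and is a.s. infinite if `μ(A) = ∞`), independently for disjoint
sets. -/
structure IsPoissonProcess {Ω E : Type*} [MeasurableSpace Ω] [MeasurableSpace E]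
    (P : Measure Ω) (μ : Measure E) (Pt : Ω → Set E) : Prop where
  measurable_count : ∀ A : Set E, MeasurableSet A → Measurable fun ω => (Pt ω ∩ A).encard
  map_count : ∀ A : Set E, MeasurableSet A → μ A ≠ ∞ →
    P.map (fun ω => (Pt ω ∩ A).encard) =
      (poissonMeasure (μ A).toNNReal).map (fun k : ℕ => (k : ℕ∞))
  count_eq_top : ∀ A : Set E, MeasurableSet A → μ A = ∞ → ∀ᵐ ω ∂P, (Pt ω ∩ A).encard = ⊤
  indep_count : ∀ (m : ℕ) (A : Fin m → Set E), (∀ i, MeasurableSet (A i)) →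
    Pairwise (fun i j => Disjoint (A i) (A j)) →
    iIndepFun (fun i ω => (Pt ω ∩ A i).encard) P

/-- `Z` is a stochastic process on `[t₀, t₁)` whose sample paths are, almost surely, in
`D[t₀, t₁)` and satisfy the jump equation driven by the random point set `Pt`. -/
structure IsJumpProcess {Ω : Type*} [MeasurableSpace Ω] (P : Measure Ω)
    (t₀ t₁ a₀ : ℝ) (α : ℝ → ℝ) (Pt : Ω → Set (ℝ × ℝ)) (Z : Ω → ℝ → ℝ) : Prop where
  aemeasurable : ∀ t ∈ Ico t₀ t₁, AEMeasurable (fun ω => Z ω t) P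
  ae_isJumpPath : ∀ᵐ ω ∂P, IsJumpPath t₀ t₁ a₀ α (Pt ω) (Z ω)

/-- The domain `(t₀, t₁) × ((-∞, -K] ∪ [K, ∞))`. -/
def outerStrip (t₀ t₁ K : ℝ) : Set (ℝ × ℝ) := Ioo t₀ t₁ ×ˢ (Iic (-K) ∪ Ici K)

/-- The points `(x, y)` of `S` with `|y| ≤ n`. -/
def truncate (S : Set (ℝ × ℝ)) (n : ℕ) : Set (ℝ × ℝ) := {p ∈ S | |p.2| ≤ (n : ℝ)}

end SelfStabilizing

end

noncomputable section

namespace SelfStabilizing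

/-! ### A discrete Gronwall inequality -/

/-! The argument is pathwise first and probabilistic afterwards. By the mean value theorem, a point
with ordinate `y` changes the jump by at most `lipConst α * absPowAB a b y` times the difference of
the left limits of the two paths (`abs_signedPow_sub_le`). On the finitely many points with `|y| ≤
n`, a discrete Gronwall inequality (`le_mul_prod_of_le_add_sum`) then bounds the error by the tail
of the jump sizes over `|y| > n`, times the product of `1 + lipConst α * absPowAB a b y` over `|y| ≤
n` (`abs_truncate_sub_le`). Campbell's formula makes `absPowAB` almost surely summable over the
points, so this product is bounded uniformly in `n`. The truncated paths therefore converge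
uniformly to a solution (`exists_isJumpPath`), and every solution is their limit
(`eqOn_of_isJumpPath`).

For the mean error, the tail and the product depend on the process over disjoint sets, so they are
independent. The tail has its mean from Campbell's formula. The product is the exponential of a sum
of `log (1 + c)`, where `c` denotes the Lipschitz constant of a point, and the exponential moment of
a Poisson process contains `exp (log (1 + c)) - 1 = c`. Hence its mean is at most the exponential of
the integral of `c` over the strip (`lintegral_lintegral_mul_ennexp_le`). Bounding the product by
`exp (∑ c)` before taking means would leave `exp c - 1` in place of `c` and lose the stated
constant. -/

theorem prod_one_add_le_of_subset {ι : Type*} [DecidableEq ι] {c : ι → ℝ} (hc : ∀ i, 0 ≤ c i)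
    {F G : Finset ι} (h : F ⊆ G) : ∏ p ∈ F, (1 + c p) ≤ ∏ p ∈ G, (1 + c p) := by
  rw [← Finset.prod_sdiff h]
  refine le_mul_of_one_le_left (Finset.prod_nonneg fun p _ => by linarith [hc p]) ?_
  exact Finset.one_le_prod fun p _ => by linarith [hc p]

/-- Expansion of the product in increasing order of `x`: each new factor adds `c p` times the
product of the earlier ones. Ties in `x` drop out of the strict filter, hence an inequality and not
an equality. -/
theorem one_add_sum_mul_prod_le_prod_one_add {ι : Type*} [DecidableEq ι] (x c : ι → ℝ)
    (hc : ∀ i, 0 ≤ c i) (F : Finset ι) :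
    1 + ∑ p ∈ F, c p * ∏ q ∈ F with x q < x p, (1 + c q) ≤ ∏ p ∈ F, (1 + c p) := by
  induction F using Finset.induction_on_max_value x with
  | empty => simp
  | insert i s his hmax ih =>
    rw [Finset.prod_insert his, Finset.sum_insert his]
    have h1 : ∀ p ∈ s, (insert i s).filter (fun q => x q < x p) = s.filter (fun q => x q < x p) := by
      intro p hp
      rw [Finset.filter_insert, if_neg (not_lt.2 (hmax p hp))]
    have h2 : ∑ p ∈ s, c p * ∏ q ∈ insert i s with x q < x p, (1 + c q)
        = ∑ p ∈ s, c p * ∏ q ∈ s with x q < x p, (1 + c q) :=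
      Finset.sum_congr rfl fun p hp => by rw [h1 p hp]
    have h3 : ∏ q ∈ insert i s with x q < x i, (1 + c q) ≤ ∏ q ∈ s, (1 + c q) := by
      rw [Finset.filter_insert, if_neg (lt_irrefl _)]
      exact prod_one_add_le_of_subset hc (Finset.filter_subset _ _)
    rw [h2]
    nlinarith [mul_le_mul_of_nonneg_left h3 (hc i)]

/-- A Gronwall inequality for a measure with finitely many atoms, placed at `x p` with mass `c p`;
`l p` stands for the left limit of `h` at `x p`. -/
theorem le_mul_prod_of_le_add_sum {ι : Type*} [DecidableEq ι] {t₀ t₁ : ℝ} {F : Finset ι}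
    {x c l : ι → ℝ} {h : ℝ → ℝ} {R : ℝ} (hR : 0 ≤ R) (hc : ∀ i, 0 ≤ c i)
    (hx : ∀ p ∈ F, x p ∈ Ioo t₀ t₁)
    (hl : ∀ p ∈ F, ∀ B, (∀ s ∈ Ico t₀ (x p), h s ≤ B) → l p ≤ B)
    (hh : ∀ t ∈ Ico t₀ t₁, h t ≤ R + ∑ p ∈ F with x p ≤ t, c p * l p)
    {t : ℝ} (ht : t ∈ Ico t₀ t₁) : h t ≤ R * ∏ p ∈ F, (1 + c p) := by
  have key : ∀ n : ℕ, ∀ t ∈ Ico t₀ t₁, (F.filter (fun p => x p ≤ t)).card = n →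
      h t ≤ R * ∏ p ∈ F with x p ≤ t, (1 + c p) := by
    -- Strong induction on the number of atoms up to time `t`; it replaces an ordering of the atoms.
    intro n
    induction n using Nat.strong_induction_on with
    | _ n ih =>
    intro t ht hn
    set G := F.filter (fun p => x p ≤ t) with hG
    have hlb : ∀ p ∈ G, l p ≤ R * ∏ q ∈ G with x q < x p, (1 + c q) := by
      intro p hp
      have hpF : p ∈ F := (Finset.mem_filter.1 hp).1
      have hpt : x p ≤ t := (Finset.mem_filter.1 hp).2
      refine hl p hpF _ fun s hs => ?_
      have hsub : F.filter (fun q => x q ≤ s) ⊆ G.filter (fun q => x q < x p) := by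
        intro q hq
        rw [Finset.mem_filter] at hq
        rw [Finset.mem_filter, hG, Finset.mem_filter]
        exact ⟨⟨hq.1, by linarith [hs.2, hq.2]⟩, by linarith [hs.2, hq.2]⟩
      -- The atom `p` is counted at time `t` but at no time before `x p`, so the count drops
      -- strictly.
      have hlt : (F.filter (fun q => x q ≤ s)).card < n := by
        rw [← hn]
        refine (Finset.card_le_card hsub).trans_lt (Finset.card_lt_card ?_)
        refine Finset.filter_ssubset.2 ⟨p, hp, lt_irrefl _⟩
      refine (ih _ hlt s ⟨hs.1, by linarith [hs.2, (hx p hpF).2]⟩ rfl).trans ?_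
      refine mul_le_mul_of_nonneg_left ?_ hR
      exact prod_one_add_le_of_subset hc hsub
    calc h t ≤ R + ∑ p ∈ G, c p * l p := hh t ht
      _ ≤ R + ∑ p ∈ G, c p * (R * ∏ q ∈ G with x q < x p, (1 + c q)) := by
        gcongr with p hp
        · exact hc p
        · exact hlb p hp
      _ = R * (1 + ∑ p ∈ G, c p * ∏ q ∈ G with x q < x p, (1 + c q)) := by
        rw [mul_add, mul_one, Finset.mul_sum]
        congr 1
        exact Finset.sum_congr rfl fun p _ => by ring
      _ ≤ _ := mul_le_mul_of_nonneg_left (one_add_sum_mul_prod_le_prod_one_add x c hc G) hR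
  refine (key _ t ht rfl).trans (mul_le_mul_of_nonneg_left ?_ hR)
  exact prod_one_add_le_of_subset hc (Finset.filter_subset _ _)

/-! ### Bounds for the jumps -/

/-- The largest possible modulus of a jump caused by a point with ordinate `y`. -/
def jumpBound (a b y : ℝ) : ℝ := max (|y| ^ (-1 / a)) (|y| ^ (-1 / b))

theorem jumpBound_nonneg (a b y : ℝ) : 0 ≤ jumpBound a b y :=
  le_max_of_le_left (Real.rpow_nonneg (abs_nonneg y) _)

theorem absPowAB_eq (a b y : ℝ) :
    absPowAB a b y = jumpBound a b y * (1 + abs (Real.log |y|)) := by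
  rw [absPowAB, jumpBound, max_mul_of_nonneg _ _ (by positivity)]

theorem jumpBound_le_absPowAB (a b y : ℝ) : jumpBound a b y ≤ absPowAB a b y := by
  rw [absPowAB_eq]
  nlinarith [mul_nonneg (jumpBound_nonneg a b y) (abs_nonneg (Real.log |y|))]

theorem absPowAB_nonneg (a b y : ℝ) : 0 ≤ absPowAB a b y :=
  (jumpBound_nonneg a b y).trans (jumpBound_le_absPowAB a b y)

theorem rpow_neg_inv_le_jumpBound {a b s y : ℝ} (ha : 0 < a) (hs : s ∈ Icc a b) (hy : y ≠ 0) :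
    |y| ^ (-1 / s) ≤ jumpBound a b y := by
  have hs0 : 0 < s := ha.trans_le hs.1
  have hy' : 0 < |y| := abs_pos.2 hy
  have h1 : -1 / a ≤ -1 / s := by
    rw [neg_div, neg_div]; exact neg_le_neg (one_div_le_one_div_of_le ha hs.1)
  have h2 : -1 / s ≤ -1 / b := by
    rw [neg_div, neg_div]; exact neg_le_neg (one_div_le_one_div_of_le hs0 hs.2)
  rcases le_total 1 |y| with h | h
  · exact le_max_of_le_right (Real.rpow_le_rpow_of_exponent_le h h2)
  · exact le_max_of_le_left (Real.rpow_le_rpow_of_exponent_ge hy' h h1)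

theorem abs_signedPow {y : ℝ} (hy : y ≠ 0) (s : ℝ) : |signedPow y s| = |y| ^ s := by
  rw [signedPow, abs_mul, abs_of_nonneg (Real.rpow_nonneg (abs_nonneg y) s)]
  rcases lt_or_gt_of_ne hy with h | h
  · simp [Real.sign_of_neg h]
  · simp [Real.sign_of_pos h]

theorem abs_signedPow_le_jumpBound {a b s y : ℝ} (ha : 0 < a) (hs : s ∈ Icc a b) (hy : y ≠ 0) :
    |signedPow y (-1 / s)| ≤ jumpBound a b y := by
  rw [abs_signedPow hy]
  exact rpow_neg_inv_le_jumpBound ha hs hy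

theorem lipConst_nonneg (α : ℝ → ℝ) : 0 ≤ lipConst α :=
  Real.iSup_nonneg fun _ => by positivity

theorem abs_deriv_div_sq_le_lipConst {a b : ℝ} {α : ℝ → ℝ} (ha : 0 < a)
    (hα_mem : ∀ ξ, α ξ ∈ Icc a b) (hα_deriv : ∃ C : ℝ, ∀ ξ, |deriv α ξ| ≤ C) (ξ : ℝ) :
    |deriv α ξ| / α ξ ^ 2 ≤ lipConst α := by
  obtain ⟨C, hC⟩ := hα_deriv
  refine le_ciSup (f := fun ξ => |deriv α ξ| / α ξ ^ 2) ⟨C / a ^ 2, ?_⟩ ξ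
  rintro _ ⟨v, rfl⟩
  have hC0 : 0 ≤ C := (abs_nonneg _).trans (hC v)
  have := (hα_mem v).1
  simp only
  gcongr
  exact hC v

/-- Mean value theorem for `ξ ↦ |y| ^ (-1 / α ξ)`. Its derivative carries the factors `log |y|` and
`α' / α ^ 2`, which is where the logarithm in `absPowAB` and the constant `lipConst α` come from. -/
theorem abs_signedPow_sub_le {a b : ℝ} {α : ℝ → ℝ} (ha : 0 < a) (hα : ContDiff ℝ 1 α)
    (hα_mem : ∀ ξ, α ξ ∈ Icc a b) (hα_deriv : ∃ C : ℝ, ∀ ξ, |deriv α ξ| ≤ C) {y : ℝ}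
    (hy : y ≠ 0) (u v : ℝ) :
    |signedPow y (-1 / α u) - signedPow y (-1 / α v)| ≤
      lipConst α * absPowAB a b y * |u - v| := by
  have hy' : 0 < |y| := abs_pos.2 hy
  have hpos : ∀ ξ, 0 < α ξ := fun ξ => ha.trans_le (hα_mem ξ).1
  have hd : ∀ ξ, HasDerivAt (fun ξ => |y| ^ (-1 / α ξ))
      (Real.log |y| * (deriv α ξ / α ξ ^ 2) * |y| ^ (-1 / α ξ)) ξ := by
    intro ξ
    have h1 : HasDerivAt α (deriv α ξ) ξ :=
      (hα.differentiable (by norm_num) ξ).hasDerivAt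
    have h2 : HasDerivAt (fun ξ => -1 / α ξ) (deriv α ξ / α ξ ^ 2) ξ := by
      exact ((hasDerivAt_const ξ (-1 : ℝ)).fun_div h1 (hpos ξ).ne').congr_deriv (by simp)
    exact h2.const_rpow hy'
  have hb : ∀ ξ, ‖Real.log |y| * (deriv α ξ / α ξ ^ 2) * |y| ^ (-1 / α ξ)‖ ≤
      lipConst α * absPowAB a b y := by
    intro ξ
    rw [Real.norm_eq_abs, abs_mul, abs_mul, abs_div, abs_of_nonneg (sq_nonneg (α ξ)),
      abs_of_nonneg (Real.rpow_nonneg hy'.le _), absPowAB_eq]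
    have h1 := abs_deriv_div_sq_le_lipConst ha hα_mem hα_deriv ξ
    have h2 := rpow_neg_inv_le_jumpBound ha (hα_mem ξ) hy
    calc abs (Real.log |y|) * (|deriv α ξ| / α ξ ^ 2) * |y| ^ (-1 / α ξ)
        ≤ (1 + abs (Real.log |y|)) * lipConst α * jumpBound a b y := by
          gcongr
          · exact mul_nonneg (by positivity) (lipConst_nonneg α)
          · linarith
      _ = _ := by ring
  have h := (convex_univ : Convex ℝ (univ : Set ℝ)).norm_image_sub_le_of_norm_hasDerivWithin_le
    (fun ξ _ => (hd ξ).hasDerivWithinAt) (fun ξ _ => hb ξ) (mem_univ v) (mem_univ u)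
  rw [Real.norm_eq_abs, Real.norm_eq_abs] at h
  refine le_trans (le_of_eq ?_) h
  rw [signedPow, signedPow, ← mul_sub, abs_mul]
  rcases lt_or_gt_of_ne hy with h | h
  · simp [Real.sign_of_neg h]
  · simp [Real.sign_of_pos h]

/-! ### Left limits of càdlàg functions -/

theorem IsCadlag.tendsto_leftLim {t₀ t₁ : ℝ} {f : ℝ → ℝ} (hf : IsCadlag t₀ t₁ f) {u : ℝ}
    (hu : u ∈ Ioc t₀ t₁) : Tendsto f (𝓝[<] u) (𝓝 (Function.leftLim f u)) := by
  obtain ⟨l, hl⟩ := hf.2 u hu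
  exact tendsto_leftLim_of_tendsto ⟨l, hl⟩

/-- Supplies the hypothesis on `l` in the Gronwall inequality. -/
theorem abs_leftLim_sub_le {t₀ t₁ : ℝ} {f g : ℝ → ℝ} (hf : IsCadlag t₀ t₁ f)
    (hg : IsCadlag t₀ t₁ g) {u B : ℝ} (hu : u ∈ Ioc t₀ t₁)
    (h : ∀ s ∈ Ico t₀ u, |f s - g s| ≤ B) :
    |Function.leftLim f u - Function.leftLim g u| ≤ B := by
  refine le_of_tendsto ((hf.tendsto_leftLim hu).sub (hg.tendsto_leftLim hu)).abs ?_
  filter_upwards [Ico_mem_nhdsLT hu.1] with s hs using h s hs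

/-! ### Jump paths driven by a fixed point set -/

/-- The contribution of the point `p` to the value at time `t` of a path `f`. -/
def jumpTerm (t₀ : ℝ) (α : ℝ → ℝ) (f : ℝ → ℝ) (t : ℝ) (p : ℝ × ℝ) : ℝ :=
  (Ioc t₀ t).indicator (fun x => signedPow p.2 (-1 / α (Function.leftLim f x))) p.1

theorem isJumpPath_iff {t₀ t₁ a₀ : ℝ} {α : ℝ → ℝ} {S : Set (ℝ × ℝ)} {f : ℝ → ℝ} :
    IsJumpPath t₀ t₁ a₀ α S f ↔ IsCadlag t₀ t₁ f ∧
      ∀ t ∈ Ico t₀ t₁, HasSum (S.indicator (jumpTerm t₀ α f t)) (f t - a₀) := by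
  refine and_congr_right fun _ => forall₂_congr fun t _ => ?_
  rw [← hasSum_subtype_iff_indicator]
  rfl

theorem isJumpPath_coe_finset {t₀ t₁ a₀ : ℝ} {α : ℝ → ℝ} {F : Finset (ℝ × ℝ)} {f : ℝ → ℝ} :
    IsJumpPath t₀ t₁ a₀ α F f ↔ IsCadlag t₀ t₁ f ∧
      ∀ t ∈ Ico t₀ t₁, f t - a₀ = ∑ p ∈ F, jumpTerm t₀ α f t p := by
  refine and_congr_right fun _ => forall₂_congr fun t _ => ?_
  exact ⟨fun h => h.unique (F.hasSum (jumpTerm t₀ α f t)),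
    fun h => h ▸ F.hasSum (jumpTerm t₀ α f t)⟩

theorem snd_ne_zero_of_mem_outerStrip {t₀ t₁ K : ℝ} (hK : 0 < K) {p : ℝ × ℝ}
    (hp : p ∈ outerStrip t₀ t₁ K) : p.2 ≠ 0 := by
  intro h
  have := hp.2
  rw [h] at this
  rcases this with h | h
  · exact absurd (mem_Iic.1 h) (by linarith)
  · exact absurd (mem_Ici.1 h) (by linarith)

section

variable {a b t₀ t₁ a₀ K : ℝ} {α : ℝ → ℝ}

theorem abs_jumpTerm_le (ha : 0 < a) (hα_mem : ∀ ξ, α ξ ∈ Icc a b) (f : ℝ → ℝ) (t : ℝ)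
    {p : ℝ × ℝ} (hp : p.2 ≠ 0) : |jumpTerm t₀ α f t p| ≤ jumpBound a b p.2 := by
  rw [jumpTerm, indicator_apply]
  split_ifs
  · exact abs_signedPow_le_jumpBound ha (hα_mem _) hp
  · simpa using jumpBound_nonneg a b p.2

theorem abs_jumpTerm_sub_le (ha : 0 < a) (hα : ContDiff ℝ 1 α) (hα_mem : ∀ ξ, α ξ ∈ Icc a b)
    (hα_deriv : ∃ C : ℝ, ∀ ξ, |deriv α ξ| ≤ C) (f g : ℝ → ℝ) (t : ℝ)
    {p : ℝ × ℝ} (hp : p.2 ≠ 0) :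
    |jumpTerm t₀ α f t p - jumpTerm t₀ α g t p| ≤ if p.1 ≤ t then
      lipConst α * absPowAB a b p.2 * |Function.leftLim f p.1 - Function.leftLim g p.1|
      else 0 := by
  rw [jumpTerm, jumpTerm]
  by_cases h : p.1 ∈ Ioc t₀ t
  · rw [indicator_of_mem h, indicator_of_mem h, if_pos h.2]
    exact abs_signedPow_sub_le ha hα hα_mem hα_deriv hp _ _
  · rw [indicator_of_notMem h, indicator_of_notMem h, sub_zero, abs_zero]
    have := mul_nonneg (mul_nonneg (lipConst_nonneg α) (absPowAB_nonneg a b p.2))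
      (abs_nonneg (Function.leftLim f p.1 - Function.leftLim g p.1))
    split_ifs
    · exact this
    · exact le_rfl

/-- Comparison of two paths driven by point sets `S` and `S'` that share the finite set `F`. -/
theorem abs_sub_le_of_isJumpPath (ha : 0 < a) (hK : 0 < K) (hα : ContDiff ℝ 1 α)
    (hα_mem : ∀ ξ, α ξ ∈ Icc a b) (hα_deriv : ∃ C : ℝ, ∀ ξ, |deriv α ξ| ≤ C)
    {S S' : Set (ℝ × ℝ)} (hS : S ⊆ outerStrip t₀ t₁ K) (hS' : S' ⊆ outerStrip t₀ t₁ K)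
    {F : Finset (ℝ × ℝ)} (hF : ↑F ⊆ S) (hF' : ↑F ⊆ S') {R R' : ℝ}
    (hR : HasSum ((S \ F).indicator fun p => jumpBound a b p.2) R)
    (hR' : HasSum ((S' \ F).indicator fun p => jumpBound a b p.2) R')
    {f g : ℝ → ℝ} (hf : IsJumpPath t₀ t₁ a₀ α S f) (hg : IsJumpPath t₀ t₁ a₀ α S' g)
    {t : ℝ} (ht : t ∈ Ico t₀ t₁) :
    |f t - g t| ≤ (R + R') * ∏ p ∈ F, (1 + lipConst α * absPowAB a b p.2) := by
  rw [isJumpPath_iff] at hf hg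
  have hRR' : 0 ≤ R + R' := add_nonneg
    (hR.nonneg fun p => indicator_nonneg (fun p _ => jumpBound_nonneg a b p.2) p)
    (hR'.nonneg fun p => indicator_nonneg (fun p _ => jumpBound_nonneg a b p.2) p)
  refine le_mul_prod_of_le_add_sum (h := fun t => |f t - g t|) (x := Prod.fst)
    (l := fun p => |Function.leftLim f p.1 - Function.leftLim g p.1|)
    (c := fun p => lipConst α * absPowAB a b p.2) hRR'
    (fun p => mul_nonneg (lipConst_nonneg α) (absPowAB_nonneg a b p.2))
    (fun p hp => (hS (hF hp)).1) ?_ ?_ ht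
  · intro p hp B hB
    exact abs_leftLim_sub_le hf.1 hg.1 (Ioo_subset_Ioc_self (hS (hF hp)).1) hB
  · intro t ht
    -- Termwise majorant on the shared points, where the Lipschitz bound applies. A point outside
    -- `F` is estimated crudely by `jumpBound`, once for each path, which gives `R + R'`.
    let G : ℝ × ℝ → ℝ := fun p => if p ∈ F then (if p.1 ≤ t then
      lipConst α * absPowAB a b p.2 * |Function.leftLim f p.1 - Function.leftLim g p.1|
      else 0) else 0
    have hG : HasSum G (∑ p ∈ F with p.1 ≤ t,
        lipConst α * absPowAB a b p.2 * |Function.leftLim f p.1 - Function.leftLim g p.1|) := by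
      have := hasSum_sum_of_ne_finset_zero (f := G) (s := F)
        (L := SummationFilter.unconditional _) fun p hp => if_neg hp
      rwa [Finset.sum_congr rfl fun p hp => if_pos hp, ← Finset.sum_filter] at this
    have h1 := (hf.2 t ht).sub (hg.2 t ht)
    have h2 := (hR.add hR').add hG
    have h3 := h1.norm_le_of_bounded h2 fun p => ?_
    · rw [Real.norm_eq_abs] at h3
      simpa using h3
    rw [Real.norm_eq_abs]
    by_cases hpF : p ∈ F
    · rw [indicator_of_mem (hF hpF), indicator_of_mem (hF' hpF),
        indicator_of_notMem fun h => h.2 hpF, indicator_of_notMem fun h => h.2 hpF, add_zero,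
        zero_add]
      simp only [G, if_pos hpF]
      exact abs_jumpTerm_sub_le ha hα hα_mem hα_deriv f g t
        (snd_ne_zero_of_mem_outerStrip hK (hS (hF hpF)))
    · have key : ∀ (T : Set (ℝ × ℝ)) (u : ℝ → ℝ), T ⊆ outerStrip t₀ t₁ K →
          |T.indicator (jumpTerm t₀ α u t) p| ≤
            (T \ F).indicator (fun p => jumpBound a b p.2) p := by
        intro T u hT
        by_cases hpT : p ∈ T
        · rw [indicator_of_mem hpT, indicator_of_mem (show p ∈ T \ F from ⟨hpT, hpF⟩)]
          exact abs_jumpTerm_le ha hα_mem u t (snd_ne_zero_of_mem_outerStrip hK (hT hpT))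
        · rw [indicator_of_notMem hpT, indicator_of_notMem fun h => hpT h.1, abs_zero]
      simp only [G, if_neg hpF, add_zero]
      exact (abs_sub _ _).trans (add_le_add (key S f hS) (key S' g hS'))

/-- Makes the Gronwall factor independent of the truncation level, for the pathwise existence and
uniqueness arguments. -/
theorem prod_one_add_le_exp {ι : Type*} {c : ι → ℝ} (hc : ∀ i, 0 ≤ c i) {S : Set ι} {F : Finset ι}
    (hF : ↑F ⊆ S) (hS : Summable (S.indicator c)) :
    ∏ p ∈ F, (1 + c p) ≤ Real.exp (∑' p, S.indicator c p) := by
  calc ∏ p ∈ F, (1 + c p) ≤ ∏ p ∈ F, Real.exp (c p) :=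
        Finset.prod_le_prod (fun p _ => by linarith [hc p])
          fun p _ => by linarith [Real.add_one_le_exp (c p)]
    _ = Real.exp (∑ p ∈ F, S.indicator c p) := by
        rw [← Real.exp_sum]
        congr 1
        exact Finset.sum_congr rfl fun p hp => (indicator_of_mem (hF hp) c).symm
    _ ≤ _ := Real.exp_le_exp.2
        (hS.sum_le_tsum F fun p _ => indicator_nonneg (fun p _ => hc p) p)

/-- A path for a finite driving set exists. -/
theorem exists_isJumpPath_finset (a₀ : ℝ) (α : ℝ → ℝ) (F : Finset (ℝ × ℝ))
    (hF : ∀ p ∈ F, p.1 ∈ Ioo t₀ t₁) : ∃ f, IsJumpPath t₀ t₁ a₀ α F f := by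
  induction F using Finset.induction_on_max_value (Prod.fst : ℝ × ℝ → ℝ) with
  | empty =>
    refine ⟨fun _ => a₀, isJumpPath_coe_finset.2 ⟨⟨fun u _ => tendsto_const_nhds,
      fun u _ => ⟨a₀, tendsto_const_nhds⟩⟩, fun t _ => by simp⟩⟩
  | insert q s hqs hmax ih =>
    obtain ⟨f, hf⟩ := ih fun p hp => hF p (Finset.mem_insert_of_mem hp)
    rw [isJumpPath_coe_finset] at hf
    have hq := hF q (Finset.mem_insert_self q s)
    -- `q` has maximal abscissa, so its jump is determined by the path `f` already built, and adding
    -- it alters nothing before time `q.1`.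
    set v : ℝ := signedPow q.2 (-1 / α (Function.leftLim f q.1)) with hv
    let g : ℝ → ℝ := fun t => f t + if q.1 ≤ t then v else 0
    have hleft : ∀ u ∈ Ioc t₀ t₁, ∃ w : ℝ, (u ≤ q.1 → w = 0) ∧
        Tendsto g (𝓝[<] u) (𝓝 (Function.leftLim f u + w)) := by
      intro u hu
      rcases le_or_gt u q.1 with h | h
      · refine ⟨0, fun _ => rfl, (hf.1.tendsto_leftLim hu).add
          (tendsto_const_nhds.congr' ?_)⟩
        filter_upwards [self_mem_nhdsWithin] with s hs
        rw [if_neg (not_le.2 ((mem_Iio.1 hs).trans_le h))]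
      · refine ⟨v, fun h' => absurd h' (not_le.2 h), (hf.1.tendsto_leftLim hu).add
          (tendsto_const_nhds.congr' ?_)⟩
        filter_upwards [Ico_mem_nhdsLT h] with s hs
        rw [if_pos hs.1]
    have hlim : ∀ u ∈ Ioc t₀ t₁, u ≤ q.1 → Function.leftLim g u = Function.leftLim f u := by
      intro u hu huq
      obtain ⟨w, hw, hlim⟩ := hleft u hu
      rw [hw huq, add_zero] at hlim
      exact leftLim_eq_of_tendsto hlim
    refine ⟨g, isJumpPath_coe_finset.2 ⟨⟨fun u hu => ?_, fun u hu => ?_⟩, fun t ht => ?_⟩⟩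
    · refine (hf.1.1 u hu).add (tendsto_const_nhds.congr' ?_)
      rcases le_or_gt q.1 u with h | h
      · filter_upwards [self_mem_nhdsWithin] with s hs
        rw [if_pos h, if_pos (h.trans (mem_Ioi.1 hs).le)]
      · filter_upwards [Ioo_mem_nhdsGT h] with s hs
        rw [if_neg (not_le.2 h), if_neg (not_le.2 hs.2)]
    · obtain ⟨w, -, hlim⟩ := hleft u hu
      exact ⟨_, hlim⟩
    · have hterm : ∀ p ∈ insert q s, jumpTerm t₀ α g t p = jumpTerm t₀ α f t p := by
        intro p hp
        have hpq : p.1 ≤ q.1 := by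
          rcases Finset.mem_insert.1 hp with rfl | h
          · exact le_rfl
          · exact hmax p h
        simp only [jumpTerm, indicator_apply]
        rw [hlim p.1 (Ioo_subset_Ioc_self (hF p hp)) hpq]
      rw [Finset.sum_congr rfl hterm, Finset.sum_insert hqs, ← hf.2 t ht]
      have hqt : jumpTerm t₀ α f t q = if q.1 ≤ t then v else 0 := by
        rw [jumpTerm, indicator_apply]
        exact if_congr ⟨fun h => h.2, fun h => ⟨hq.1, h⟩⟩ rfl rfl
      rw [hqt]
      simp only [g]
      ring

end

/-! ### Existence and uniqueness for a summable point set -/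

section

variable {a b t₀ t₁ a₀ K : ℝ} {α : ℝ → ℝ}

theorem truncate_subset (S : Set (ℝ × ℝ)) (n : ℕ) : truncate S n ⊆ S := fun _ hp => hp.1

theorem summable_indicator_of_subset {ι : Type*} {g h : ι → ℝ} (hg : ∀ p, 0 ≤ g p)
    (hgh : ∀ p, g p ≤ h p) {S T : Set ι} (hTS : T ⊆ S) (hS : Summable (S.indicator h)) :
    Summable (T.indicator g) := by
  refine Summable.of_nonneg_of_le (fun p => indicator_nonneg (fun p _ => hg p) p) (fun p => ?_) hS
  refine (indicator_le_indicator (hgh p)).trans ?_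
  exact indicator_le_indicator_of_subset hTS (fun p => (hg p).trans (hgh p)) p

theorem summable_jumpBound {S T : Set (ℝ × ℝ)} (hTS : T ⊆ S)
    (hS : Summable (S.indicator fun p => absPowAB a b p.2)) :
    Summable (T.indicator fun p => jumpBound a b p.2) :=
  summable_indicator_of_subset (g := fun p : ℝ × ℝ => jumpBound a b p.2)
    (h := fun p : ℝ × ℝ => absPowAB a b p.2) (fun p => jumpBound_nonneg a b p.2)
    (fun p => jumpBound_le_absPowAB a b p.2) hTS hS

/-- On `0 < |y| ≤ n` the weight `absPowAB` is at least `(n + 1) ^ (-1 / a)`, and a summable family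
exceeds a positive threshold only finitely often. The `+ 1` keeps the base positive for `n = 0`. -/
theorem finite_truncate (ha : 0 < a) (hK : 0 < K) {S : Set (ℝ × ℝ)}
    (hSs : S ⊆ outerStrip t₀ t₁ K)
    (hS : Summable (S.indicator fun p => absPowAB a b p.2)) (n : ℕ) : (truncate S n).Finite := by
  have hn : (0 : ℝ) < (n : ℝ) + 1 := by positivity
  have h := hS.tendsto_cofinite_zero.eventually_lt_const (Real.rpow_pos_of_pos hn (-1 / a))
  rw [eventually_cofinite] at h
  refine h.subset fun p hp => ?_
  have hp0 : 0 < |p.2| := abs_pos.2 (snd_ne_zero_of_mem_outerStrip hK (hSs hp.1))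
  rw [mem_ofPred_eq, not_lt, indicator_of_mem hp.1]
  refine le_trans ?_ (jumpBound_le_absPowAB a b p.2)
  refine le_max_of_le_left (Real.rpow_le_rpow_of_nonpos hp0 (hp.2.trans (by linarith)) ?_)
  rw [neg_div]
  exact neg_nonpos.2 (by positivity)

/-- The total size of the jumps of `S` that are left out in `truncate S n`. -/
def tailSum (a b : ℝ) (S : Set (ℝ × ℝ)) (n : ℕ) : ℝ :=
  ∑' p, (S \ truncate S n).indicator (fun p => jumpBound a b p.2) p

theorem tailSum_nonneg (a b : ℝ) (S : Set (ℝ × ℝ)) (n : ℕ) : 0 ≤ tailSum a b S n :=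
  tsum_nonneg fun p => indicator_nonneg (fun p _ => jumpBound_nonneg a b p.2) p

theorem tendsto_tailSum {S : Set (ℝ × ℝ)}
    (hS : Summable (S.indicator fun p => absPowAB a b p.2)) :
    Tendsto (tailSum a b S) atTop (𝓝 0) := by
  have := tendsto_tsum_of_dominated_convergence (𝓕 := atTop)
    (f := fun n p => (S \ truncate S n).indicator (fun p => jumpBound a b p.2) p)
    (g := fun _ => (0 : ℝ)) (bound := S.indicator fun p => jumpBound a b p.2)
    (summable_jumpBound subset_rfl hS) (fun p => ?_) (Eventually.of_forall fun n p => ?_)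
  · simpa [tailSum] using! this
  · refine tendsto_const_nhds.congr' ?_
    filter_upwards [eventually_ge_atTop ⌈|p.2|⌉₊] with n hn
    rw [indicator_of_notMem]
    exact fun h => h.2 ⟨h.1, (Nat.le_ceil _).trans (by exact_mod_cast hn)⟩
  · rw [Real.norm_of_nonneg (indicator_nonneg (fun p _ => jumpBound_nonneg a b p.2) p)]
    exact indicator_le_indicator_of_subset sdiff_subset (fun p => jumpBound_nonneg a b p.2) p

/-- Comparison of a path with the path for the truncated driving set. -/
theorem abs_truncate_sub_le (ha : 0 < a) (hK : 0 < K) (hα : ContDiff ℝ 1 α)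
    (hα_mem : ∀ ξ, α ξ ∈ Icc a b) (hα_deriv : ∃ C : ℝ, ∀ ξ, |deriv α ξ| ≤ C)
    {S S' : Set (ℝ × ℝ)} (hSs : S ⊆ outerStrip t₀ t₁ K)
    (hS : Summable (S.indicator fun p => absPowAB a b p.2)) (hS' : S' ⊆ S) {n : ℕ}
    (hn : truncate S n ⊆ S') {f g : ℝ → ℝ} (hf : IsJumpPath t₀ t₁ a₀ α (truncate S n) f)
    (hg : IsJumpPath t₀ t₁ a₀ α S' g) {t : ℝ} (ht : t ∈ Ico t₀ t₁) :
    |f t - g t| ≤ tailSum a b S n *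
      ∏ p ∈ (finite_truncate ha hK hSs hS n).toFinset, (1 + lipConst α * absPowAB a b p.2) := by
  set F := (finite_truncate ha hK hSs hS n).toFinset with hF
  have hFc : (F : Set (ℝ × ℝ)) = truncate S n := (finite_truncate ha hK hSs hS n).coe_toFinset
  -- Since `F` is the whole truncated set, only the other path has a remainder.
  have h1 : HasSum ((truncate S n \ F).indicator fun p => jumpBound a b p.2) 0 := by
    rw [hFc, sdiff_self, indicator_empty]
    exact hasSum_zero
  have h2 : Summable ((S' \ F).indicator fun p => jumpBound a b p.2) :=
    summable_jumpBound (sdiff_subset.trans hS') hS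
  refine (abs_sub_le_of_isJumpPath ha hK hα hα_mem hα_deriv ((truncate_subset S n).trans hSs)
    (hS'.trans hSs) hFc.subset (hFc.subset.trans hn) h1 h2.hasSum hf hg ht).trans ?_
  rw [zero_add]
  gcongr
  · refine Finset.prod_nonneg fun p _ => ?_
    have := mul_nonneg (lipConst_nonneg α) (absPowAB_nonneg a b p.2)
    linarith
  · rw [tailSum, hFc]
    refine h2.tsum_le_tsum (fun p => ?_) (summable_jumpBound sdiff_subset hS) |>.trans' ?_
    · rw [hFc]
      exact indicator_le_indicator_of_subset (sdiff_subset_sdiff_left hS')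
        (fun p => jumpBound_nonneg a b p.2) p
    · rw [hFc]

theorem abs_truncate_sub_le_exp (ha : 0 < a) (hK : 0 < K) (hα : ContDiff ℝ 1 α)
    (hα_mem : ∀ ξ, α ξ ∈ Icc a b) (hα_deriv : ∃ C : ℝ, ∀ ξ, |deriv α ξ| ≤ C)
    {S S' : Set (ℝ × ℝ)} (hSs : S ⊆ outerStrip t₀ t₁ K)
    (hS : Summable (S.indicator fun p => absPowAB a b p.2)) (hS' : S' ⊆ S) {n : ℕ}
    (hn : truncate S n ⊆ S') {f g : ℝ → ℝ} (hf : IsJumpPath t₀ t₁ a₀ α (truncate S n) f)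
    (hg : IsJumpPath t₀ t₁ a₀ α S' g) {t : ℝ} (ht : t ∈ Ico t₀ t₁) :
    |f t - g t| ≤ tailSum a b S n *
      Real.exp (∑' p, S.indicator (fun p => lipConst α * absPowAB a b p.2) p) := by
  refine (abs_truncate_sub_le ha hK hα hα_mem hα_deriv hSs hS hS' hn hf hg ht).trans ?_
  refine mul_le_mul_of_nonneg_left ?_ (tailSum_nonneg a b S n)
  refine prod_one_add_le_exp (c := fun p : ℝ × ℝ => lipConst α * absPowAB a b p.2)
    (fun p => mul_nonneg (lipConst_nonneg α) (absPowAB_nonneg a b p.2)) ?_ ?_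
  · rw [Finite.coe_toFinset]
    exact truncate_subset S n
  · refine (hS.mul_left (lipConst α)).congr fun p => ?_
    rw [indicator_const_mul]

theorem exists_isJumpPath_truncate (a₀ : ℝ) (α : ℝ → ℝ) (ha : 0 < a) (hK : 0 < K)
    {S : Set (ℝ × ℝ)} (hSs : S ⊆ outerStrip t₀ t₁ K)
    (hS : Summable (S.indicator fun p => absPowAB a b p.2)) (n : ℕ) :
    ∃ f, IsJumpPath t₀ t₁ a₀ α (truncate S n) f := by
  have h := exists_isJumpPath_finset (t₀ := t₀) (t₁ := t₁) a₀ α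
    (finite_truncate ha hK hSs hS n).toFinset
    fun p hp => (hSs (((finite_truncate ha hK hSs hS n).mem_toFinset.1 hp).1)).1
  rwa [Finite.coe_toFinset] at h

/-- Any solution is the pointwise limit of one fixed sequence of truncated paths. -/
theorem eqOn_of_isJumpPath (ha : 0 < a) (hK : 0 < K) (hα : ContDiff ℝ 1 α)
    (hα_mem : ∀ ξ, α ξ ∈ Icc a b) (hα_deriv : ∃ C : ℝ, ∀ ξ, |deriv α ξ| ≤ C)
    {S : Set (ℝ × ℝ)} (hSs : S ⊆ outerStrip t₀ t₁ K)
    (hS : Summable (S.indicator fun p => absPowAB a b p.2)) {f g : ℝ → ℝ}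
    (hf : IsJumpPath t₀ t₁ a₀ α S f) (hg : IsJumpPath t₀ t₁ a₀ α S g) :
    EqOn f g (Ico t₀ t₁) := by
  intro t ht
  choose u hu using exists_isJumpPath_truncate a₀ α ha hK hSs hS
  set C := Real.exp (∑' p, S.indicator (fun p => lipConst α * absPowAB a b p.2) p)
  have h : ∀ v, IsJumpPath t₀ t₁ a₀ α S v → Tendsto (fun n => u n t) atTop (𝓝 (v t)) := by
    intro v hv
    refine tendsto_iff_dist_tendsto_zero.2 (squeeze_zero (fun n => dist_nonneg) (fun n => ?_)
      (by simpa using (tendsto_tailSum hS).mul_const C))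
    rw [Real.dist_eq]
    exact abs_truncate_sub_le_exp ha hK hα hα_mem hα_deriv hSs hS subset_rfl
      (truncate_subset S n) (hu n) hv ht
  exact tendsto_nhds_unique (h f hf) (h g hg)

/-- The truncated paths are uniformly Cauchy on `[t₀, t₁)`. Uniform limits preserve the càdlàg
property and commute with left limits; dominated convergence, with `jumpBound` as majorant, passes
the equation to the limit. -/
theorem exists_isJumpPath (a₀ : ℝ) (ha : 0 < a) (hK : 0 < K) (hα : ContDiff ℝ 1 α)
    (hα_mem : ∀ ξ, α ξ ∈ Icc a b) (hα_deriv : ∃ C : ℝ, ∀ ξ, |deriv α ξ| ≤ C)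
    {S : Set (ℝ × ℝ)} (hSs : S ⊆ outerStrip t₀ t₁ K)
    (hS : Summable (S.indicator fun p => absPowAB a b p.2)) :
    ∃ f, IsJumpPath t₀ t₁ a₀ α S f := by
  choose u hu using exists_isJumpPath_truncate (t₀ := t₀) (t₁ := t₁) a₀ α ha hK hSs hS
  set C := Real.exp (∑' p, S.indicator (fun p => lipConst α * absPowAB a b p.2) p)
  have hr : Tendsto (fun n => tailSum a b S n * C) atTop (𝓝 0) := by
    simpa using (tendsto_tailSum hS).mul_const C
  have hdist : ∀ n m, n ≤ m → ∀ t ∈ Ico t₀ t₁, |u n t - u m t| ≤ tailSum a b S n * C :=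
    fun n m hnm t ht => abs_truncate_sub_le_exp ha hK hα hα_mem hα_deriv hSs hS
      (truncate_subset S m) (fun p hp => ⟨hp.1, hp.2.trans (by exact_mod_cast hnm)⟩) (hu n) (hu m) ht
  have hlim : ∀ t, ∃ l, t ∈ Ico t₀ t₁ → Tendsto (fun n => u n t) atTop (𝓝 l) := by
    intro t
    by_cases ht : t ∈ Ico t₀ t₁
    · obtain ⟨l, hl⟩ := cauchySeq_tendsto_of_complete (cauchySeq_of_le_tendsto_0' _
        (fun n m hnm => by rw [Real.dist_eq]; exact hdist n m hnm t ht) hr)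
      exact ⟨l, fun _ => hl⟩
    · exact ⟨0, fun h => absurd h ht⟩
  choose f hf using hlim
  have hbound : ∀ n, ∀ t ∈ Ico t₀ t₁, |u n t - f t| ≤ tailSum a b S n * C := by
    intro n t ht
    refine le_of_tendsto ((tendsto_const_nhds.sub (hf t ht)).abs) ?_
    filter_upwards [eventually_ge_atTop n] with m hm using hdist n m hm t ht
  have hunif : TendstoUniformlyOn u f atTop (Ico t₀ t₁) := by
    rw [Metric.tendstoUniformlyOn_iff]
    intro ε hε
    filter_upwards [hr.eventually_lt_const hε] with n hn t ht
    rw [dist_comm, Real.dist_eq]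
    exact (hbound n t ht).trans_lt hn
  -- Exchange of the limits in `n` and `s → x-`, justified by uniform convergence.
  have hleft : ∀ x ∈ Ioc t₀ t₁, ∃ l,
      Tendsto (fun n => Function.leftLim (u n) x) atTop (𝓝 l) ∧ Tendsto f (𝓝[<] x) (𝓝 l) := by
    intro x hx
    obtain ⟨l, hl⟩ := cauchySeq_tendsto_of_complete (cauchySeq_of_le_tendsto_0'
      (s := fun n => Function.leftLim (u n) x) _
      (fun n m hnm => by
        rw [Real.dist_eq]
        exact abs_leftLim_sub_le (hu n).1 (hu m).1 hx
          fun s hs => hdist n m hnm s ⟨hs.1, hs.2.trans_le hx.2⟩) hr)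
    refine ⟨l, hl, ?_⟩
    refine (hunif.tendstoUniformlyOnFilter.mono_right ?_).tendsto_of_eventually_tendsto
      (Eventually.of_forall fun n => (hu n).1.tendsto_leftLim hx) hl
    exact le_principal_iff.2 (mem_of_superset (Ico_mem_nhdsLT hx.1)
      (Ico_subset_Ico_right hx.2))
  have hcad : IsCadlag t₀ t₁ f := by
    refine ⟨fun x hx => ?_, fun x hx => ?_⟩
    · refine (hunif.tendstoUniformlyOnFilter.mono_right ?_).tendsto_of_eventually_tendsto
        (Eventually.of_forall fun n => (hu n).1.1 x hx) (hf x hx)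
      exact le_principal_iff.2 (mem_of_superset (Ioo_mem_nhdsGT hx.2)
        (fun s hs => ⟨hx.1.trans hs.1.le, hs.2⟩))
    · obtain ⟨l, -, hl⟩ := hleft x hx
      exact ⟨l, hl⟩
  have hleft' : ∀ x ∈ Ioc t₀ t₁,
      Tendsto (fun n => Function.leftLim (u n) x) atTop (𝓝 (Function.leftLim f x)) := by
    intro x hx
    obtain ⟨l, hl, hl'⟩ := hleft x hx
    rwa [leftLim_eq_of_tendsto hl']
  refine ⟨f, isJumpPath_iff.2 ⟨hcad, fun t ht => ?_⟩⟩
  have hV := summable_jumpBound subset_rfl hS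
  have hle : ∀ (T : Set (ℝ × ℝ)) (g : ℝ → ℝ), T ⊆ S → ∀ p,
      ‖T.indicator (jumpTerm t₀ α g t) p‖ ≤ S.indicator (fun p => jumpBound a b p.2) p := by
    intro T g hT p
    by_cases hp : p ∈ T
    · rw [indicator_of_mem hp, indicator_of_mem (hT hp)]
      exact abs_jumpTerm_le ha hα_mem g t (snd_ne_zero_of_mem_outerStrip hK (hSs (hT hp)))
    · rw [indicator_of_notMem hp, norm_zero]
      exact indicator_nonneg (fun p _ => jumpBound_nonneg a b p.2) p
  have hconv := tendsto_tsum_of_dominated_convergence (𝓕 := atTop)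
    (f := fun n p => (truncate S n).indicator (jumpTerm t₀ α (u n) t) p)
    (g := S.indicator (jumpTerm t₀ α f t)) hV (fun p => ?_)
    (Eventually.of_forall fun n p => hle _ _ (truncate_subset S n) p)
  · have heq : ∀ n, ∑' p, (truncate S n).indicator (jumpTerm t₀ α (u n) t) p = u n t - a₀ :=
      fun n => ((isJumpPath_iff.1 (hu n)).2 t ht).tsum_eq
    simp only [heq] at hconv
    rw [tendsto_nhds_unique ((hf t ht).sub_const a₀) hconv]
    exact (Summable.of_norm_bounded hV (hle S f subset_rfl)).hasSum
  · by_cases hp : p ∈ S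
    · rw [indicator_of_mem hp]
      -- A fixed point lies in all late truncations; its jump then converges by continuity of `α`
      -- and of the exponential.
      have hev : ∀ᶠ n : ℕ in atTop, (truncate S n).indicator (jumpTerm t₀ α (u n) t) p =
          jumpTerm t₀ α (u n) t p := by
        filter_upwards [eventually_ge_atTop ⌈|p.2|⌉₊] with n hn
        exact indicator_of_mem (show p ∈ truncate S n from
          ⟨hp, (Nat.le_ceil _).trans (by exact_mod_cast hn)⟩) _
      refine Tendsto.congr' (EventuallyEq.symm hev) ?_
      by_cases hpt : p.1 ∈ Ioc t₀ t
      · simp only [jumpTerm, indicator_of_mem hpt]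
        have hp1 := hleft' p.1 (Ioo_subset_Ioc_self (hSs hp).1)
        have hα0 : α (Function.leftLim f p.1) ≠ 0 := (ha.trans_le (hα_mem _).1).ne'
        have h1 : Tendsto (fun n => -1 / α (Function.leftLim (u n) p.1)) atTop
            (𝓝 (-1 / α (Function.leftLim f p.1))) :=
          tendsto_const_nhds.div ((hα.continuous.tendsto _).comp hp1) hα0
        refine tendsto_const_nhds.mul (tendsto_const_nhds.rpow h1 (Or.inl ?_))
        exact (abs_pos.2 (snd_ne_zero_of_mem_outerStrip hK (hSs hp))).ne'
      · simp only [jumpTerm, indicator_of_notMem hpt]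
        exact tendsto_const_nhds
    · rw [indicator_of_notMem hp]
      have hn : ∀ n, p ∉ truncate S n := fun n h => hp (truncate_subset S n h)
      simp only [indicator_of_notMem (hn _)]
      exact tendsto_const_nhds

end

/-! ### The counting measure of a point set -/

/-- The measure that puts unit mass on each point of `S`. -/
def pointMeasure {E : Type*} [MeasurableSpace E] (S : Set E) : Measure E :=
  Measure.sum fun p : S => Measure.dirac (p : E)

section

variable {E : Type*} [MeasurableSpace E]

theorem pointMeasure_apply (S : Set E) {A : Set E} (hA : MeasurableSet A) :
    pointMeasure S A = ((S ∩ A).encard : ℝ≥0∞) := by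
  rw [pointMeasure, Measure.sum_apply _ hA, ← ENNReal.tsum_set_one,
    tsum_subtype (S ∩ A) (fun _ => (1 : ℝ≥0∞))]
  simp only [Measure.dirac_apply' _ hA]
  rw [tsum_subtype S (A.indicator 1), indicator_indicator]
  rfl

theorem lintegral_pointMeasure (S : Set E) {g : E → ℝ≥0∞} (hg : Measurable g) :
    ∫⁻ x, g x ∂pointMeasure S = ∑' p : S, g p := by
  rw [pointMeasure, lintegral_sum_measure]
  exact tsum_congr fun p => lintegral_dirac' _ hg

theorem setLIntegral_pointMeasure (S : Set E) {A : Set E} (hA : MeasurableSet A) {g : E → ℝ≥0∞}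
    (hg : Measurable g) : ∫⁻ x in A, g x ∂pointMeasure S = ∑' p, (S ∩ A).indicator g p := by
  rw [← lintegral_indicator hA, lintegral_pointMeasure S (hg.indicator hA),
    tsum_subtype S (A.indicator g), indicator_indicator]

end

/-! ### Exponentials with values in `[0, ∞]` -/

/-- The exponential function on `[0, ∞]`. -/
def ennexp (x : ℝ≥0∞) : ℝ≥0∞ := EReal.exp (x : EReal)

theorem ennexp_zero : ennexp 0 = 1 := by simp [ennexp]

theorem ennexp_add (x y : ℝ≥0∞) : ennexp (x + y) = ennexp x * ennexp y := by
  rw [ennexp, EReal.coe_ennreal_add, EReal.exp_add, ennexp, ennexp]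

theorem ennexp_mono : Monotone ennexp := fun _ _ h =>
  EReal.exp_monotone (EReal.coe_ennreal_le_coe_ennreal_iff.2 h)

theorem continuous_ennexp : Continuous ennexp :=
  ENNReal.continuous_exp.comp continuous_coe_ennreal_ereal

theorem ennexp_sum {ι : Type*} (s : Finset ι) (f : ι → ℝ≥0∞) :
    ennexp (∑ i ∈ s, f i) = ∏ i ∈ s, ennexp (f i) := by
  classical
  induction s using Finset.induction_on with
  | empty => simp [ennexp_zero]
  | insert i s hi ih => rw [Finset.sum_insert hi, Finset.prod_insert hi, ennexp_add, ih]

theorem ennexp_ofReal {x : ℝ} (hx : 0 ≤ x) :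
    ennexp (ENNReal.ofReal x) = ENNReal.ofReal (Real.exp x) := by
  rw [ennexp, EReal.coe_ennreal_ofReal, max_eq_left hx, EReal.exp_coe]

/-! ### Moments of the Poisson distribution -/

theorem lintegral_poissonMeasure (r : NNReal) (h : ℕ → ℝ≥0∞) :
    ∫⁻ k, h k ∂poissonMeasure r =
      ∑' k : ℕ, h k * ENNReal.ofReal (Real.exp (-r) * r ^ k / k.factorial) := by
  rw [lintegral_countable']
  simp only [poissonMeasure_singleton]

theorem lintegral_natCast_poissonMeasure (r : NNReal) :
    ∫⁻ k, (k : ℝ≥0∞) ∂poissonMeasure r = r := by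
  rw [lintegral_poissonMeasure, tsum_eq_zero_add' ENNReal.summable]
  have h := (hasSum_one_poissonMeasure r).mul_left (r : ℝ)
  rw [mul_one] at h
  -- The factor `k + 1` cancels against the factorial and leaves `r` times the Poisson weight of
  -- `k`.
  have h2 : ∀ k : ℕ, ((k + 1 : ℕ) : ℝ≥0∞) *
      ENNReal.ofReal (Real.exp (-r) * r ^ (k + 1) / (k + 1).factorial) =
      ENNReal.ofReal (r * (Real.exp (-r) * r ^ k / k.factorial)) := by
    intro k
    rw [← ENNReal.ofReal_natCast, ← ENNReal.ofReal_mul (by positivity)]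
    congr 1
    rw [Nat.factorial_succ]
    push_cast
    field_simp
    ring
  simp only [h2, Nat.cast_zero, zero_mul, zero_add]
  rw [← ENNReal.ofReal_tsum_of_nonneg (fun k => by positivity) h.summable, h.tsum_eq]
  simp

theorem lintegral_ennexp_poissonMeasure (r v : NNReal) :
    ∫⁻ k, ennexp (v * (k : ℝ≥0∞)) ∂poissonMeasure r = ennexp ((ennexp v - 1) * r) := by
  have hv : ∀ k : ℕ, ennexp (v * (k : ℝ≥0∞)) = ENNReal.ofReal (Real.exp v ^ k) := by
    intro k
    have h1 : (v : ℝ≥0∞) * (k : ℝ≥0∞) = ENNReal.ofReal (k * v) := by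
      rw [ENNReal.ofReal_mul (by positivity), ENNReal.ofReal_natCast, ENNReal.ofReal_coe_nnreal,
        mul_comm]
    rw [h1, ennexp_ofReal (by positivity), Real.exp_nat_mul]
  have h := (NormedSpace.expSeries_div_hasSum_exp (Real.exp v * r : ℝ)).mul_left (Real.exp (-r))
  rw [← Real.exp_eq_exp_ℝ, ← Real.exp_add] at h
  rw [lintegral_poissonMeasure]
  have h2 : ∀ k : ℕ, ennexp (v * (k : ℝ≥0∞)) *
      ENNReal.ofReal (Real.exp (-r) * r ^ k / k.factorial) =
      ENNReal.ofReal (Real.exp (-r) * ((Real.exp v * r) ^ k / k.factorial)) := by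
    intro k
    rw [hv, ← ENNReal.ofReal_mul (by positivity), mul_pow]
    congr 1
    ring
  simp only [h2]
  rw [← ENNReal.ofReal_tsum_of_nonneg (fun k => by positivity) h.summable, h.tsum_eq]
  have hv1 : 0 ≤ Real.exp v - 1 := by linarith [Real.add_one_le_exp (v : ℝ), v.2]
  have h3 : (ennexp v - 1) * r = ENNReal.ofReal ((Real.exp v - 1) * r) := by
    have h4 : ennexp (v : ℝ≥0∞) = ENNReal.ofReal (Real.exp v) := by
      rw [← ennexp_ofReal v.coe_nonneg]
      exact congrArg ennexp ENNReal.ofReal_coe_nnreal.symm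
    rw [h4, ← ENNReal.ofReal_one,
      ← ENNReal.ofReal_sub _ zero_le_one, ENNReal.ofReal_mul hv1, ENNReal.ofReal_coe_nnreal]
  rw [h3, ennexp_ofReal (by positivity)]
  congr 2
  ring

/-! ### Moment formulas for Poisson processes -/

section

variable {Ω E : Type*} [MeasurableSpace Ω] [MeasurableSpace E] {P : Measure Ω}
  {μ : Measure E} {Pt : Ω → Set E}

theorem IsPoissonProcess.measurable_pointMeasure (h : IsPoissonProcess P μ Pt) :
    Measurable fun ω => pointMeasure (Pt ω) := by
  refine Measure.measurable_of_measurable_coe _ fun A hA => ?_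
  simp only [pointMeasure_apply _ hA]
  exact (measurable_of_countable ENat.toENNReal).comp (h.measurable_count A hA)

theorem IsPoissonProcess.lintegral_comp_count (h : IsPoissonProcess P μ Pt) {A : Set E}
    (hA : MeasurableSet A) (hμ : μ A ≠ ∞) (u : ℝ≥0∞ → ℝ≥0∞) :
    ∫⁻ ω, u (pointMeasure (Pt ω) A) ∂P = ∫⁻ k, u (k : ℝ≥0∞) ∂poissonMeasure (μ A).toNNReal := by
  simp only [pointMeasure_apply _ hA]
  have h1 := lintegral_map (μ := P) (measurable_of_countable fun k : ℕ∞ => u (k : ℝ≥0∞))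
    (h.measurable_count A hA)
  rw [← h1, h.map_count A hA hμ,
    lintegral_map (measurable_of_countable _) (measurable_of_countable _)]
  simp

theorem IsPoissonProcess.lintegral_pointMeasure_apply [IsProbabilityMeasure P]
    (h : IsPoissonProcess P μ Pt) {A : Set E} (hA : MeasurableSet A) :
    ∫⁻ ω, pointMeasure (Pt ω) A ∂P = μ A := by
  by_cases hμ : μ A = ∞
  · have h1 : ∀ᵐ ω ∂P, pointMeasure (Pt ω) A = ∞ := by
      filter_upwards [h.count_eq_top A hA hμ] with ω hω
      rw [pointMeasure_apply _ hA, hω, ENat.toENNReal_top]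
    rw [lintegral_congr_ae h1, hμ]
    simp
  · rw [h.lintegral_comp_count hA hμ fun x => x, lintegral_natCast_poissonMeasure,
      ENNReal.coe_toNNReal hμ]

/-- Campbell's formula. -/
theorem IsPoissonProcess.lintegral_lintegral [IsProbabilityMeasure P]
    (h : IsPoissonProcess P μ Pt) {g : E → ℝ≥0∞} (hg : Measurable g) :
    ∫⁻ ω, ∫⁻ x, g x ∂pointMeasure (Pt ω) ∂P = ∫⁻ x, g x ∂μ := by
  have h1 : P.bind (fun ω => pointMeasure (Pt ω)) = μ := by
    ext A hA
    rw [Measure.bind_apply hA h.measurable_pointMeasure.aemeasurable,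
      h.lintegral_pointMeasure_apply hA]
  rw [← Measure.lintegral_bind h.measurable_pointMeasure.aemeasurable hg.aemeasurable, h1]

theorem IsPoissonProcess.iIndepFun_pointMeasure (h : IsPoissonProcess P μ Pt) {ι : Type*}
    [Fintype ι] {A : ι → Set E} (hA : ∀ i, MeasurableSet (A i))
    (hd : Pairwise fun i j => Disjoint (A i) (A j)) :
    iIndepFun (fun i ω => pointMeasure (Pt ω) (A i)) P := by
  have e := Fintype.equivFin ι
  have h1 := h.indep_count _ (fun i => A (e.symm i)) (fun i => hA _)
    fun i j hij => hd (e.symm.injective.ne hij)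
  have h2 := h1.precomp e.injective
  have h3 := h2.comp (fun _ k => (k : ℝ≥0∞)) fun _ => measurable_of_countable _
  convert h3 using 3 with i ω
  simp [pointMeasure_apply _ (hA i)]

theorem IsPoissonProcess.measurable_lintegral (h : IsPoissonProcess P μ Pt) {g : E → ℝ≥0∞}
    (hg : Measurable g) {B : Set E} (hB : MeasurableSet B) :
    Measurable fun ω => ∫⁻ x in B, g x ∂pointMeasure (Pt ω) := by
  simp only [← lintegral_indicator hB]
  exact (Measure.measurable_lintegral (hg.indicator hB)).comp h.measurable_pointMeasure

/-- The level sets of `φ` inside `B`, together with `A`, are disjoint, so their counts are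
independent. The exponential splits into one factor per level set, each evaluated by the exponential
moment of a Poisson variable. In the index type, `none` stands for `A`. -/
theorem IsPoissonProcess.lintegral_mul_ennexp_simpleFunc [IsProbabilityMeasure P]
    (h : IsPoissonProcess P μ Pt) {A B : Set E} (hA : MeasurableSet A) (hB : MeasurableSet B)
    (hAB : Disjoint A B) (hμB : μ B ≠ ∞) (φ : SimpleFunc E ℝ≥0∞) (hφ : ∀ x, φ x ≠ ∞) :
    ∫⁻ ω, pointMeasure (Pt ω) A * ennexp (∫⁻ x in B, φ x ∂pointMeasure (Pt ω)) ∂P =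
      μ A * ennexp (∫⁻ x in B, (ennexp (φ x) - 1) ∂μ) := by
  let C : Option φ.range → Set E := fun o => o.elim A fun v => φ ⁻¹' {(v : ℝ≥0∞)} ∩ B
  have hC : ∀ o, MeasurableSet (C o) := by
    rintro (_ | v)
    · exact hA
    · exact (φ.measurableSet_fiber _).inter hB
  have hCd : Pairwise fun i j => Disjoint (C i) (C j) := by
    rintro (_ | v) (_ | w) hvw
    · exact absurd rfl hvw
    · exact hAB.mono_right inter_subset_right
    · exact (hAB.mono_right inter_subset_right).symm
    · refine (Disjoint.preimage φ (disjoint_singleton.2 fun h => hvw ?_)).mono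
        inter_subset_left inter_subset_left
      rw [Subtype.ext h]
  let u : Option φ.range → ℝ≥0∞ → ℝ≥0∞ := fun o => o.elim id fun v x => ennexp (v * x)
  have hu : ∀ o, Measurable (u o) := by
    rintro (_ | v)
    · exact measurable_id
    · exact continuous_ennexp.measurable.comp (measurable_id.const_mul _)
  have hind := (h.iIndepFun_pointMeasure hC hCd).comp u hu
  have hprod := lintegral_prod_eq_prod_lintegral_of_indepFun Finset.univ _ hind
    fun o => (hu o).comp ((Measure.measurable_coe (hC o)).comp h.measurable_pointMeasure)
  simp only [Fintype.prod_option] at hprod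
  have hL : ∀ ω, ennexp (∫⁻ x in B, φ x ∂pointMeasure (Pt ω)) =
      ∏ v : φ.range, (u (some v) ∘ fun ω => pointMeasure (Pt ω) (C (some v))) ω := by
    intro ω
    have h1 := SimpleFunc.lintegral_eq_lintegral φ ((pointMeasure (Pt ω)).restrict B)
    rw [SimpleFunc.lintegral_restrict] at h1
    rw [h1, ennexp_sum, ← Finset.prod_coe_sort]
    rfl
  have hR : ∀ v : φ.range,
      ∫⁻ ω, (u (some v) ∘ fun ω => pointMeasure (Pt ω) (C (some v))) ω ∂P =
        ennexp ((ennexp v - 1) * μ (φ ⁻¹' {(v : ℝ≥0∞)} ∩ B)) := by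
    rintro ⟨v, hv⟩
    have hv' : v ≠ ∞ := by
      obtain ⟨x, rfl⟩ := SimpleFunc.mem_range.1 hv
      exact hφ x
    lift v to NNReal using hv'
    have hfin : μ (φ ⁻¹' {(v : ℝ≥0∞)} ∩ B) ≠ ∞ :=
      ne_top_of_le_ne_top hμB (measure_mono inter_subset_right)
    have := h.lintegral_comp_count (A := φ ⁻¹' {(v : ℝ≥0∞)} ∩ B) (hC (some ⟨v, hv⟩)) hfin
      fun x => ennexp (v * x)
    rw [lintegral_ennexp_poissonMeasure, ENNReal.coe_toNNReal hfin] at this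
    exact this
  have hR2 : ennexp (∫⁻ x in B, (ennexp (φ x) - 1) ∂μ) =
      ∏ v : φ.range, ennexp ((ennexp v - 1) * μ (φ ⁻¹' {(v : ℝ≥0∞)} ∩ B)) := by
    have h1 := SimpleFunc.lintegral_eq_lintegral (φ.map fun y => ennexp y - 1) (μ.restrict B)
    rw [SimpleFunc.map_lintegral] at h1
    simp only [SimpleFunc.coe_map, Function.comp_apply] at h1
    rw [h1, ennexp_sum, ← Finset.prod_coe_sort]
    simp only [Measure.restrict_apply (φ.measurableSet_fiber _)]
  rw [hR2, ← Finset.prod_congr rfl fun v _ => hR v]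
  have hA1 : ∫⁻ ω, (u none ∘ fun ω => pointMeasure (Pt ω) (C none)) ω ∂P = μ A :=
    h.lintegral_pointMeasure_apply hA
  rw [hA1] at hprod
  rw [← hprod]
  refine lintegral_congr fun ω => ?_
  rw [hL]
  rfl

/-- Monotone approximation of `φ` by finite-valued simple functions. Only the upper bound is needed,
so no limit is taken on the right. -/
theorem IsPoissonProcess.lintegral_mul_ennexp_le [IsProbabilityMeasure P]
    (h : IsPoissonProcess P μ Pt) {A B : Set E} (hA : MeasurableSet A) (hB : MeasurableSet B)
    (hAB : Disjoint A B) (hμB : μ B ≠ ∞) {φ : E → ℝ≥0∞} (hφ : Measurable φ) :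
    ∫⁻ ω, pointMeasure (Pt ω) A * ennexp (∫⁻ x in B, φ x ∂pointMeasure (Pt ω)) ∂P ≤
      μ A * ennexp (∫⁻ x in B, (ennexp (φ x) - 1) ∂μ) := by
  let ψ := SimpleFunc.eapprox φ
  have hψm : ∀ ν : Measure E, Monotone fun k => ∫⁻ x in B, ψ k x ∂ν :=
    fun ν k l hkl => lintegral_mono (SimpleFunc.monotone_eapprox φ hkl)
  have hmono : Monotone fun k ω =>
      pointMeasure (Pt ω) A * ennexp (∫⁻ x in B, ψ k x ∂pointMeasure (Pt ω)) :=
    fun k l hkl ω => mul_le_mul_right (ennexp_mono (hψm _ hkl)) _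
  have hsup : ∀ ω, pointMeasure (Pt ω) A * ennexp (∫⁻ x in B, φ x ∂pointMeasure (Pt ω)) =
      ⨆ k, pointMeasure (Pt ω) A * ennexp (∫⁻ x in B, ψ k x ∂pointMeasure (Pt ω)) := by
    intro ω
    rw [← ENNReal.mul_iSup]
    congr 1
    have h1 := lintegral_iSup (μ := (pointMeasure (Pt ω)).restrict B)
      (fun k => (ψ k).measurable) fun k l hkl => SimpleFunc.monotone_eapprox φ hkl
    simp only [ψ, SimpleFunc.iSup_eapprox_apply hφ] at h1
    rw [h1]
    refine (iSup_eq_of_tendsto (fun k l hkl => ennexp_mono (hψm _ hkl)) ?_).symm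
    exact (continuous_ennexp.tendsto _).comp (tendsto_atTop_iSup (hψm _))
  simp only [hsup]
  rw [lintegral_iSup (fun k => ?_) hmono]
  · refine iSup_le fun k => ?_
    rw [h.lintegral_mul_ennexp_simpleFunc hA hB hAB hμB (ψ k)
      fun x => (SimpleFunc.eapprox_lt_top φ k x).ne]
    gcongr
    refine ennexp_mono (lintegral_mono fun x => tsub_le_tsub_right (ennexp_mono ?_) 1)
    rw [← SimpleFunc.iSup_eapprox_apply hφ x]
    exact le_iSup (fun k => SimpleFunc.eapprox φ k x) k
  · exact ((Measure.measurable_coe hA).comp h.measurable_pointMeasure).mul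
      (continuous_ennexp.measurable.comp (h.measurable_lintegral (ψ k).measurable hB))

/-- The integral over `A` of a Poisson process and an exponential functional of the process on a
disjoint set `B`. -/
theorem IsPoissonProcess.lintegral_lintegral_mul_ennexp_le [IsProbabilityMeasure P]
    (h : IsPoissonProcess P μ Pt) {A B : Set E} (hA : MeasurableSet A) (hB : MeasurableSet B)
    (hAB : Disjoint A B) (hμB : μ B ≠ ∞) {φ g : E → ℝ≥0∞} (hφ : Measurable φ)
    (hg : Measurable g) :
    ∫⁻ ω, (∫⁻ x in A, g x ∂pointMeasure (Pt ω)) *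
        ennexp (∫⁻ x in B, φ x ∂pointMeasure (Pt ω)) ∂P ≤
      (∫⁻ x in A, g x ∂μ) * ennexp (∫⁻ x in B, (ennexp (φ x) - 1) ∂μ) := by
  set Q : Ω → ℝ≥0∞ := fun ω => ennexp (∫⁻ x in B, φ x ∂pointMeasure (Pt ω)) with hQ
  set c := ennexp (∫⁻ x in B, (ennexp (φ x) - 1) ∂μ)
  have hQm : Measurable Q := continuous_ennexp.measurable.comp (h.measurable_lintegral hφ hB)
  have hN := h.measurable_pointMeasure
  -- The case of indicators says that the mean measure of the process under the weight `Q` is at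
  -- most `c • μ` on `A`. Integrating `g` against both measures gives the general case.
  have hle : ((P.withDensity Q).bind fun ω => pointMeasure (Pt ω)).restrict A ≤
      c • μ.restrict A := by
    refine Measure.le_iff.2 fun s hs => ?_
    rw [Measure.restrict_apply hs, Measure.bind_apply (hs.inter hA) hN.aemeasurable,
      Measure.smul_apply, Measure.restrict_apply hs, smul_eq_mul, mul_comm,
      lintegral_withDensity_eq_lintegral_mul P hQm
        (g := fun ω => pointMeasure (Pt ω) (s ∩ A))
        ((Measure.measurable_coe (hs.inter hA)).comp hN)]
    refine le_trans (le_of_eq (lintegral_congr fun ω => ?_))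
      (h.lintegral_mul_ennexp_le (hs.inter hA) hB (hAB.mono_left inter_subset_right) hμB hφ)
    exact mul_comm _ _
  have h1 := lintegral_mono' hle (le_refl g)
  rw [lintegral_smul_measure, smul_eq_mul, ← lintegral_indicator hA,
    Measure.lintegral_bind hN.aemeasurable (hg.indicator hA).aemeasurable,
    lintegral_withDensity_eq_lintegral_mul P hQm
      (g := fun ω => ∫⁻ x, A.indicator g x ∂pointMeasure (Pt ω))
      ((Measure.measurable_lintegral (hg.indicator hA)).comp hN)] at h1
  rw [mul_comm]
  refine le_trans (le_of_eq (lintegral_congr fun ω => ?_)) h1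
  rw [Pi.mul_apply, mul_comm, lintegral_indicator hA]

end

/-! ### Integrals of the jump bounds -/

theorem measurable_jumpBound (a b : ℝ) : Measurable (jumpBound a b) := by
  unfold jumpBound
  fun_prop

theorem measurable_absPowAB (a b : ℝ) : Measurable (absPowAB a b) := by
  have h : Measurable fun y : ℝ => 1 + abs (Real.log |y|) :=
    measurable_const.add (Real.measurable_log.comp measurable_id.abs).abs
  have h2 : absPowAB a b = fun y => jumpBound a b y * (1 + abs (Real.log |y|)) :=
    funext fun y => absPowAB_eq a b y
  rw [h2]
  exact (measurable_jumpBound a b).mul h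

/-- The logarithm is absorbed by `|log y| ≤ (y ^ ε + y ^ (-ε)) / ε`. With `ε` half the gap between
`s` and `-1`, the exponents `s ± ε` remain below `-1`. -/
theorem integrableOn_rpow_mul_one_add_log {s K : ℝ} (hs : s < -1) (hK : 0 < K) :
    IntegrableOn (fun y : ℝ => |y| ^ s * (1 + abs (Real.log |y|))) (Ioi K) := by
  set ε := (-1 - s) / 2 with hε
  have hε0 : 0 < ε := by rw [hε]; linarith
  have h1 := integrableOn_Ioi_rpow_of_lt hs hK
  have h2 := integrableOn_Ioi_rpow_of_lt (a := s + ε) (by rw [hε]; linarith) hK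
  have h3 := integrableOn_Ioi_rpow_of_lt (a := s - ε) (by linarith) hK
  refine Integrable.mono' ((h1.add (h2.div_const ε)).add (h3.div_const ε)) ?_ ?_
  · refine Measurable.aestronglyMeasurable ?_
    have h : Measurable fun y : ℝ => 1 + abs (Real.log |y|) :=
      measurable_const.add (Real.measurable_log.comp measurable_id.abs).abs
    exact (measurable_id.abs.pow_const s).mul h
  · filter_upwards [ae_restrict_mem measurableSet_Ioi] with y hy
    have hy0 : 0 < y := hK.trans hy
    have hp : 0 ≤ y ^ s := Real.rpow_nonneg hy0.le s
    rw [Real.norm_of_nonneg (by positivity), abs_of_pos hy0]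
    have hl1 : Real.log y ≤ y ^ ε / ε := Real.log_le_rpow_div hy0.le hε0
    have hl2 : -Real.log y ≤ y ^ (-ε) / ε := by
      rw [← Real.log_inv, Real.rpow_neg hy0.le, ← Real.inv_rpow hy0.le]
      exact Real.log_le_rpow_div (inv_nonneg.2 hy0.le) hε0
    have hp1 : 0 ≤ y ^ ε / ε := by positivity
    have hp2 : 0 ≤ y ^ (-ε) / ε := by positivity
    have hl : |Real.log y| ≤ y ^ ε / ε + y ^ (-ε) / ε :=
      abs_le.2 ⟨by linarith, by linarith⟩
    simp only [Pi.add_apply]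
    calc y ^ s * (1 + |Real.log y|) ≤ y ^ s * (1 + (y ^ ε / ε + y ^ (-ε) / ε)) := by gcongr
      _ = y ^ s + y ^ s * y ^ ε / ε + y ^ s * y ^ (-ε) / ε := by ring
      _ = _ := by rw [← Real.rpow_add hy0, ← Real.rpow_add hy0, sub_eq_add_neg]

theorem neg_one_div_lt_neg_one {s : ℝ} (hs : 0 < s) (hs1 : s < 1) : -1 / s < -1 := by
  rw [div_lt_iff₀ hs]
  linarith

theorem integrableOn_absPowAB {a b K : ℝ} (ha : 0 < a) (hab : a < b) (hb : b < 1) (hK : 0 < K) :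
    IntegrableOn (fun y => absPowAB a b y) (Ioi K) :=
  (integrableOn_rpow_mul_one_add_log (neg_one_div_lt_neg_one ha (hab.trans hb)) hK).sup
    (integrableOn_rpow_mul_one_add_log (neg_one_div_lt_neg_one (ha.trans hab) hb) hK)

theorem lintegral_outerStrip {t₀ t₁ K : ℝ} (hK : 0 < K) {g : ℝ → ℝ≥0∞} (hg : Measurable g)
    (heven : ∀ y, g (-y) = g y) :
    ∫⁻ p in outerStrip t₀ t₁ K, g p.2 =
      ENNReal.ofReal (t₁ - t₀) * (2 * ∫⁻ y in Ioi K, g y) := by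
  have h1 := lintegral_prod_mul (μ := volume.restrict (Ioo t₀ t₁))
    (ν := volume.restrict (Iic (-K) ∪ Ici K)) (f := fun _ => 1) (g := g)
    aemeasurable_const hg.aemeasurable
  have h2 : ∫⁻ y in Iic (-K), g y = ∫⁻ y in Ioi K, g y := by
    have h3 := (Measure.measurePreserving_neg (volume : Measure ℝ)).setLIntegral_comp_preimage
      (measurableSet_Iic (a := -K)) hg
    rw [← h3]
    simp only [heven, neg_preimage, neg_Iic, neg_neg]
    exact setLIntegral_congr Ioi_ae_eq_Ici.symm
  have h4 : Disjoint (Iic (-K)) (Ici K) := by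
    rw [Set.disjoint_left]
    intro y hy hy'
    have := mem_Iic.1 hy
    have := mem_Ici.1 hy'
    linarith
  rw [outerStrip, Measure.volume_eq_prod, ← Measure.prod_restrict]
  simp only [one_mul, lintegral_const, Measure.restrict_apply_univ, Real.volume_Ioo] at h1
  rw [h1, lintegral_union measurableSet_Ici h4, h2, two_mul,
    setLIntegral_congr Ioi_ae_eq_Ici.symm]

theorem jumpBound_neg (a b y : ℝ) : jumpBound a b (-y) = jumpBound a b y := by
  simp [jumpBound]

theorem absPowAB_neg (a b y : ℝ) : absPowAB a b (-y) = absPowAB a b y := by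
  simp [absPowAB]

theorem jumpBound_of_one_le {a b y : ℝ} (ha : 0 < a) (hab : a < b) (hy : 1 ≤ y) :
    jumpBound a b y = y ^ (-1 / b) := by
  rw [jumpBound, abs_of_nonneg (by linarith), max_eq_right]
  refine Real.rpow_le_rpow_of_exponent_le hy ?_
  rw [neg_div, neg_div]
  exact neg_le_neg (one_div_le_one_div_of_le ha hab.le)

theorem measurableSet_lt_abs_snd (n : ℕ) : MeasurableSet {p : ℝ × ℝ | (n : ℝ) < |p.2|} :=
  measurableSet_lt measurable_const measurable_snd.abs

/-- Since `n ≥ 1`, the tail involves only `y ^ (-1 / b)`, whose integral over `(n, ∞)` is explicit.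
The factor `2` comes from the two half-lines, and `t₁ - t₀` from the abscissae. -/
theorem lintegral_jumpBound_le {a b t₀ t₁ K : ℝ} (ha : 0 < a) (hab : a < b) (hb : b < 1)
    (ht : t₀ < t₁) (hK : 0 < K) {n : ℕ} (hn : 1 ≤ n) :
    ∫⁻ p in {p : ℝ × ℝ | (n : ℝ) < |p.2|}, ENNReal.ofReal (jumpBound a b p.2)
        ∂(volume : Measure (ℝ × ℝ)).restrict (outerStrip t₀ t₁ K) ≤
      ENNReal.ofReal (2 * b * (t₁ - t₀) / (1 - b) * (n : ℝ) ^ (-(1 - b) / b)) := by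
  have hn1 : (1 : ℝ) ≤ n := by exact_mod_cast hn
  have hn0 : (0 : ℝ) < n := by linarith
  have hb0 : 0 < b := ha.trans hab
  set T : Set ℝ := {y | (n : ℝ) < |y|} with hT
  have hTm : MeasurableSet T := measurableSet_lt measurable_const measurable_id.abs
  set g : ℝ → ℝ≥0∞ := T.indicator fun y => ENNReal.ofReal (jumpBound a b y) with hg
  have hgm : Measurable g := (measurable_jumpBound a b).ennreal_ofReal.indicator hTm
  have h1 : ∫⁻ p in {p : ℝ × ℝ | (n : ℝ) < |p.2|}, ENNReal.ofReal (jumpBound a b p.2)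
        ∂(volume : Measure (ℝ × ℝ)).restrict (outerStrip t₀ t₁ K) =
      ∫⁻ p in outerStrip t₀ t₁ K, g p.2 := by
    rw [← lintegral_indicator (measurableSet_lt_abs_snd n)]
    rfl
  have h2 : ∫⁻ y in Ioi K, g y ≤ ENNReal.ofReal (b / (1 - b) * (n : ℝ) ^ (-(1 - b) / b)) := by
    have hlt := neg_one_div_lt_neg_one hb0 hb
    calc ∫⁻ y in Ioi K, g y ≤ ∫⁻ y in Ioi K, (Ioi (n : ℝ)).indicator
          (fun y => ENNReal.ofReal (y ^ (-1 / b))) y := by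
          refine setLIntegral_mono' measurableSet_Ioi fun y hy => ?_
          have hy0 : 0 < y := hK.trans hy
          by_cases hyn : (n : ℝ) < y
          · rw [indicator_of_mem (mem_Ioi.2 hyn), ← jumpBound_of_one_le ha hab (by linarith)]
            exact indicator_le_self _ _ y
          · rw [hg, indicator_of_notMem]
            · exact zero_le
            · rw [hT, mem_ofPred_eq, abs_of_pos hy0]
              exact hyn
      _ ≤ ∫⁻ y, (Ioi (n : ℝ)).indicator (fun y => ENNReal.ofReal (y ^ (-1 / b))) y :=
          setLIntegral_le_lintegral _ _
      _ = ∫⁻ y in Ioi (n : ℝ), ENNReal.ofReal (y ^ (-1 / b)) :=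
          lintegral_indicator measurableSet_Ioi _
      _ = ENNReal.ofReal (∫ y in Ioi (n : ℝ), y ^ (-1 / b)) := by
          refine (ofReal_integral_eq_lintegral_ofReal (integrableOn_Ioi_rpow_of_lt hlt hn0) ?_).symm
          filter_upwards [ae_restrict_mem measurableSet_Ioi] with y hy
          exact Real.rpow_nonneg (hn0.trans hy).le _
      _ = _ := by
          rw [integral_Ioi_rpow_of_lt hlt hn0]
          congr 1
          have e1 : -1 / b + 1 = -(1 - b) / b := by field_simp; ring
          rw [e1]
          have : 1 - b ≠ 0 := by linarith
          field_simp
  rw [h1, lintegral_outerStrip hK hgm fun y => ?_]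
  · refine (mul_le_mul_right (mul_le_mul_right h2 _) _).trans (le_of_eq ?_)
    rw [← ENNReal.ofReal_ofNat 2, ← ENNReal.ofReal_mul (by norm_num),
      ← ENNReal.ofReal_mul (by linarith)]
    congr 1
    ring
  · simp only [hg, hT, indicator_apply, mem_ofPred_eq, abs_neg, jumpBound_neg]

theorem lintegral_absPowAB {a b t₀ t₁ K : ℝ} (ha : 0 < a) (hab : a < b) (hb : b < 1)
    (ht : t₀ < t₁) (hK : 0 < K) {c : ℝ} (hc : 0 ≤ c) :
    ∫⁻ p in outerStrip t₀ t₁ K, ENNReal.ofReal (c * absPowAB a b p.2) =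
      ENNReal.ofReal (2 * c * (t₁ - t₀) * ∫ y in Ioi K, absPowAB a b y) := by
  have hm := ((measurable_absPowAB a b).const_mul c).ennreal_ofReal
  rw [lintegral_outerStrip hK hm fun y => by rw [absPowAB_neg],
    ← ofReal_integral_eq_lintegral_ofReal ((integrableOn_absPowAB ha hab hb hK).const_mul c)
      (Eventually.of_forall fun y => mul_nonneg hc (absPowAB_nonneg a b y)),
    ← ENNReal.ofReal_ofNat 2, ← ENNReal.ofReal_mul (by norm_num),
    ← ENNReal.ofReal_mul (by linarith), integral_const_mul]
  congr 1
  ring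

/-! ### Measurability of the supremum distance -/

/-- Right continuity recovers each value from dense points just to its right. A countable dense set
then makes the supremum measurable. -/
theorem supDist_eq_iSup_of_dense {t₀ t₁ : ℝ} {f g : ℝ → ℝ} (hf : IsCadlag t₀ t₁ f)
    (hg : IsCadlag t₀ t₁ g) {D : Set ℝ} (hD : Dense D) :
    supDist t₀ t₁ f g = ⨆ t : ↥(D ∩ Ico t₀ t₁), ENNReal.ofReal |f t - g t| := by
  refine le_antisymm (iSup_le fun t => ?_)
    (iSup_le fun t => le_iSup (fun t : Ico t₀ t₁ => ENNReal.ofReal |f t - g t|) ⟨t, t.2.2⟩)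
  obtain ⟨t, ht⟩ := t
  have hlim : Tendsto (fun s => ENNReal.ofReal |f s - g s|) (𝓝[>] t)
      (𝓝 (ENNReal.ofReal |f t - g t|)) :=
    ENNReal.tendsto_ofReal ((hf.1 t ht).sub (hg.1 t ht)).abs
  refine le_of_tendsto_of_frequently hlim (frequently_iff.2 fun {U} hU => ?_)
  obtain ⟨u, hu, huU⟩ := (mem_nhdsGT_iff_exists_Ioo_subset' ht.2).1 hU
  obtain ⟨s, hs, hsD⟩ := hD.inter_open_nonempty (Ioo t (min u t₁)) isOpen_Ioo
    (nonempty_Ioo.2 (lt_min hu ht.2))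
  refine ⟨s, huU ⟨hs.1, hs.2.trans_le (min_le_left _ _)⟩, ?_⟩
  exact le_iSup (fun t : ↥(D ∩ Ico t₀ t₁) => ENNReal.ofReal |f t - g t|)
    ⟨s, hsD, ht.1.trans hs.1.le, hs.2.trans_le (min_le_right _ _)⟩

theorem aemeasurable_supDist {Ω : Type*} [MeasurableSpace Ω] {P : Measure Ω} {t₀ t₁ : ℝ}
    {X Y : Ω → ℝ → ℝ} (hX : ∀ t ∈ Ico t₀ t₁, AEMeasurable (fun ω => X ω t) P)
    (hY : ∀ t ∈ Ico t₀ t₁, AEMeasurable (fun ω => Y ω t) P)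
    (hXc : ∀ᵐ ω ∂P, IsCadlag t₀ t₁ (X ω)) (hYc : ∀ᵐ ω ∂P, IsCadlag t₀ t₁ (Y ω)) :
    AEMeasurable (fun ω => supDist t₀ t₁ (X ω) (Y ω)) P := by
  obtain ⟨D, hDc, hD⟩ := TopologicalSpace.exists_countable_dense ℝ
  have : Countable ↥(D ∩ Ico t₀ t₁) := (hDc.mono inter_subset_left).to_subtype
  have h : AEMeasurable (fun ω => ⨆ t : ↥(D ∩ Ico t₀ t₁), ENNReal.ofReal |X ω t - Y ω t|) P :=
    AEMeasurable.iSup fun t => ((hX t t.2.2).sub (hY t t.2.2)).abs.ennreal_ofReal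
  refine h.congr ?_
  filter_upwards [hXc, hYc] with ω h1 h2
  exact (supDist_eq_iSup_of_dense h1 h2 hD).symm

/-! ### The Poisson-driven equation -/

section

variable {Ω : Type*} [MeasurableSpace Ω] {P : Measure Ω} [IsProbabilityMeasure P]
  {a b t₀ t₁ a₀ K : ℝ} {α : ℝ → ℝ} {Pt : Ω → Set (ℝ × ℝ)}

/-- By Campbell's formula the sum has finite mean. This is the only probabilistic input to existence
and uniqueness. -/
theorem IsPoissonProcess.ae_summable (ha : 0 < a) (hab : a < b) (hb : b < 1) (ht : t₀ < t₁)
    (hK : 0 < K) (hPt : IsPoissonProcess P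
      ((volume : Measure (ℝ × ℝ)).restrict (outerStrip t₀ t₁ K)) Pt) :
    ∀ᵐ ω ∂P, Summable ((Pt ω).indicator fun p => absPowAB a b p.2) := by
  have hm : Measurable fun p : ℝ × ℝ => ENNReal.ofReal (absPowAB a b p.2) :=
    ((measurable_absPowAB a b).comp measurable_snd).ennreal_ofReal
  have h1 := hPt.lintegral_lintegral hm
  have h2 := lintegral_absPowAB ha hab hb ht hK zero_le_one
  simp only [one_mul] at h2
  rw [h2] at h1
  have hN := (Measure.measurable_lintegral hm).comp hPt.measurable_pointMeasure
  filter_upwards [ae_lt_top hN (h1.trans_ne ENNReal.ofReal_ne_top)] with ω hω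
  rw [Function.comp_apply, lintegral_pointMeasure _ hm] at hω
  have h3 := ENNReal.summable_toReal hω.ne
  simp only [ENNReal.toReal_ofReal (absPowAB_nonneg _ _ _)] at h3
  exact summable_subtype_iff_indicator.1 h3

/-- Pathwise bound of the truncation error by functionals of the counting measure. -/
theorem supDist_truncate_le (ha : 0 < a) (hK : 0 < K) (hα : ContDiff ℝ 1 α)
    (hα_mem : ∀ ξ, α ξ ∈ Icc a b) (hα_deriv : ∃ C : ℝ, ∀ ξ, |deriv α ξ| ≤ C)
    {S : Set (ℝ × ℝ)} (hSs : S ⊆ outerStrip t₀ t₁ K)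
    (hS : Summable (S.indicator fun p => absPowAB a b p.2)) (n : ℕ) {f g : ℝ → ℝ}
    (hf : IsJumpPath t₀ t₁ a₀ α (truncate S n) f) (hg : IsJumpPath t₀ t₁ a₀ α S g) :
    supDist t₀ t₁ f g ≤
      (∫⁻ p in {p : ℝ × ℝ | (n : ℝ) < |p.2|}, ENNReal.ofReal (jumpBound a b p.2)
        ∂pointMeasure S) *
      ennexp (∫⁻ p in {p : ℝ × ℝ | (n : ℝ) < |p.2|}ᶜ,
        ENNReal.ofReal (Real.log (1 + lipConst α * absPowAB a b p.2)) ∂pointMeasure S) := by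
  have hMW : ∀ y, 0 ≤ lipConst α * absPowAB a b y := fun y =>
    mul_nonneg (lipConst_nonneg α) (absPowAB_nonneg a b y)
  set F := (finite_truncate ha hK hSs hS n).toFinset with hF
  have hFc : (F : Set (ℝ × ℝ)) = truncate S n := (finite_truncate ha hK hSs hS n).coe_toFinset
  have e1 : S ∩ {p : ℝ × ℝ | (n : ℝ) < |p.2|} = S \ truncate S n := by
    ext p
    refine ⟨fun h => ⟨h.1, fun h' => absurd h.2 (not_lt.2 h'.2)⟩, fun h => ⟨h.1, ?_⟩⟩
    by_contra h'
    exact h.2 ⟨h.1, not_lt.1 h'⟩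
  have e2 : S ∩ {p : ℝ × ℝ | (n : ℝ) < |p.2|}ᶜ = F := by
    rw [hFc]
    ext p
    exact and_congr_right fun _ => not_lt (a := (n : ℝ)) (b := |p.2|)
  have h1 : ENNReal.ofReal (tailSum a b S n) =
      ∫⁻ p in {p : ℝ × ℝ | (n : ℝ) < |p.2|}, ENNReal.ofReal (jumpBound a b p.2)
        ∂pointMeasure S := by
    have hm : Measurable fun p : ℝ × ℝ => ENNReal.ofReal (jumpBound a b p.2) :=
      ((measurable_jumpBound a b).comp measurable_snd).ennreal_ofReal
    rw [setLIntegral_pointMeasure S (measurableSet_lt_abs_snd n) hm, e1, tailSum,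
      ENNReal.ofReal_tsum_of_nonneg
        (fun p => indicator_nonneg (fun p _ => jumpBound_nonneg a b p.2) p)
        (summable_jumpBound sdiff_subset hS)]
    classical
    refine tsum_congr fun p => ?_
    rw [indicator_apply, indicator_apply]
    split_ifs
    · rfl
    · exact ENNReal.ofReal_zero
  -- The logarithm puts the product in the form of an exponential functional of the counting
  -- measure.
  have h2 : ENNReal.ofReal (∏ p ∈ F, (1 + lipConst α * absPowAB a b p.2)) =
      ennexp (∫⁻ p in {p : ℝ × ℝ | (n : ℝ) < |p.2|}ᶜ,
        ENNReal.ofReal (Real.log (1 + lipConst α * absPowAB a b p.2)) ∂pointMeasure S) := by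
    have hm : Measurable fun p : ℝ × ℝ =>
        ENNReal.ofReal (Real.log (1 + lipConst α * absPowAB a b p.2)) :=
      (Real.measurable_log.comp (measurable_const.add
        (((measurable_absPowAB a b).comp measurable_snd).const_mul _))).ennreal_ofReal
    rw [setLIntegral_pointMeasure S (measurableSet_lt_abs_snd n).compl hm, e2,
      ← sum_eq_tsum_indicator, ennexp_sum, ENNReal.ofReal_prod_of_nonneg
        fun p _ => by linarith [hMW p.2]]
    refine Finset.prod_congr rfl fun p _ => ?_
    rw [ennexp_ofReal (Real.log_nonneg (by linarith [hMW p.2])),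
      Real.exp_log (by linarith [hMW p.2])]
  rw [← h1, ← h2, ← ENNReal.ofReal_mul (tailSum_nonneg a b S n)]
  exact iSup_le fun t => ENNReal.ofReal_le_ofReal
    (abs_truncate_sub_le ha hK hα hα_mem hα_deriv hSs hS subset_rfl (truncate_subset S n) hf hg t.2)

theorem IsPoissonProcess.lintegral_supDist_le (ha : 0 < a) (hab : a < b) (hb : b < 1)
    (ht : t₀ < t₁) (hK : 0 < K) (hα : ContDiff ℝ 1 α) (hα_mem : ∀ ξ, α ξ ∈ Icc a b)
    (hα_deriv : ∃ C : ℝ, ∀ ξ, |deriv α ξ| ≤ C)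
    (hPt_sub : ∀ ω, Pt ω ⊆ outerStrip t₀ t₁ K)
    (hPt : IsPoissonProcess P
      ((volume : Measure (ℝ × ℝ)).restrict (outerStrip t₀ t₁ K)) Pt) {n : ℕ} (hn : 1 ≤ n)
    {X Y : Ω → ℝ → ℝ} (hX : ∀ᵐ ω ∂P, IsJumpPath t₀ t₁ a₀ α (truncate (Pt ω) n) (X ω))
    (hY : ∀ᵐ ω ∂P, IsJumpPath t₀ t₁ a₀ α (Pt ω) (Y ω)) :
    ∫⁻ ω, supDist t₀ t₁ (X ω) (Y ω) ∂P ≤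
      ENNReal.ofReal (2 * b * (t₁ - t₀) / (1 - b) *
        Real.exp (2 * lipConst α * (t₁ - t₀) * ∫ y in Ioi K, absPowAB a b y) *
        (n : ℝ) ^ (-(1 - b) / b)) := by
  set μ := (volume : Measure (ℝ × ℝ)).restrict (outerStrip t₀ t₁ K) with hμ
  set A : Set (ℝ × ℝ) := {p | (n : ℝ) < |p.2|} with hA
  have hAm : MeasurableSet A := measurableSet_lt_abs_snd n
  have hMW : ∀ y, 0 ≤ lipConst α * absPowAB a b y := fun y =>
    mul_nonneg (lipConst_nonneg α) (absPowAB_nonneg a b y)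
  -- Finite mean measure on `|y| ≤ n` is what the exponential moment formula requires; `A` itself
  -- has infinite measure.
  have hμA : μ Aᶜ ≠ ∞ := by
    have hsub : Aᶜ ∩ outerStrip t₀ t₁ K ⊆ Ioo t₀ t₁ ×ˢ Icc (-(n : ℝ)) n :=
      fun p hp => ⟨hp.2.1, abs_le.1 (not_lt.1 hp.1)⟩
    rw [hμ, Measure.restrict_apply hAm.compl]
    refine ne_top_of_le_ne_top ?_ (measure_mono hsub)
    rw [Measure.volume_eq_prod, Measure.prod_prod, Real.volume_Ioo, Real.volume_Icc]
    exact ENNReal.mul_ne_top ENNReal.ofReal_ne_top ENNReal.ofReal_ne_top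
  have hmφ : Measurable fun p : ℝ × ℝ =>
      ENNReal.ofReal (Real.log (1 + lipConst α * absPowAB a b p.2)) :=
    (Real.measurable_log.comp (measurable_const.add
      (((measurable_absPowAB a b).comp measurable_snd).const_mul _))).ennreal_ofReal
  have hmV : Measurable fun p : ℝ × ℝ => ENNReal.ofReal (jumpBound a b p.2) :=
    ((measurable_jumpBound a b).comp measurable_snd).ennreal_ofReal
  have hφ : ∀ p : ℝ × ℝ,
      ennexp (ENNReal.ofReal (Real.log (1 + lipConst α * absPowAB a b p.2))) - 1 =
        ENNReal.ofReal (lipConst α * absPowAB a b p.2) := by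
    intro p
    rw [ennexp_ofReal (Real.log_nonneg (by linarith [hMW p.2])),
      Real.exp_log (by linarith [hMW p.2]), ← ENNReal.ofReal_one,
      ← ENNReal.ofReal_sub _ zero_le_one, add_sub_cancel_left]
  have hI : 0 ≤ ∫ y in Ioi K, absPowAB a b y := integral_nonneg fun y => absPowAB_nonneg a b y
  have hexp : ennexp (∫⁻ p in Aᶜ, (ennexp (ENNReal.ofReal
      (Real.log (1 + lipConst α * absPowAB a b p.2))) - 1) ∂μ) ≤
      ENNReal.ofReal (Real.exp (2 * lipConst α * (t₁ - t₀) *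
        ∫ y in Ioi K, absPowAB a b y)) := by
    simp only [hφ]
    rw [← ennexp_ofReal (mul_nonneg (mul_nonneg (mul_nonneg zero_le_two (lipConst_nonneg α))
      (by linarith)) hI), ← lintegral_absPowAB ha hab hb ht hK (lipConst_nonneg α)]
    -- Enlarging `|y| ≤ n` to the whole strip makes the exponential factor independent of `n`.
    exact ennexp_mono (setLIntegral_le_lintegral _ _)
  calc ∫⁻ ω, supDist t₀ t₁ (X ω) (Y ω) ∂P
      ≤ ∫⁻ ω, (∫⁻ p in A, ENNReal.ofReal (jumpBound a b p.2) ∂pointMeasure (Pt ω)) *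
          ennexp (∫⁻ p in Aᶜ, ENNReal.ofReal (Real.log (1 + lipConst α * absPowAB a b p.2))
            ∂pointMeasure (Pt ω)) ∂P := by
        refine lintegral_mono_ae ?_
        filter_upwards [hX, hY, hPt.ae_summable ha hab hb ht hK] with ω h1 h2 h3
        exact supDist_truncate_le ha hK hα hα_mem hα_deriv (hPt_sub ω) h3 n h1 h2
    _ ≤ _ := hPt.lintegral_lintegral_mul_ennexp_le hAm hAm.compl disjoint_compl_right hμA hmφ hmV
    _ ≤ _ := mul_le_mul' (lintegral_jumpBound_le ha hab hb ht hK hn) hexp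
    _ = _ := by
        have : 0 ≤ 2 * b * (t₁ - t₀) / (1 - b) * (n : ℝ) ^ (-(1 - b) / b) := by
          have h1 : 0 ≤ t₁ - t₀ := by linarith
          have h2 : 0 ≤ 1 - b := by linarith
          have h3 : 0 ≤ b := by linarith
          positivity
        rw [← ENNReal.ofReal_mul this]
        congr 1
        ring

end

theorem tendsto_ofReal_const_mul_rpow_neg {b : ℝ} (hb0 : 0 < b) (hb : b < 1) (C : ℝ) :
    Tendsto (fun n : ℕ => ENNReal.ofReal (C * (n : ℝ) ^ (-(1 - b) / b))) atTop (𝓝 0) := by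
  have h1 : Tendsto (fun n : ℕ => (n : ℝ) ^ (-((1 - b) / b))) atTop (𝓝 0) :=
    (tendsto_rpow_neg_atTop (div_pos (by linarith) hb0)).comp tendsto_natCast_atTop_atTop
  have h2 := ENNReal.tendsto_ofReal (h1.const_mul C)
  rw [mul_zero, ENNReal.ofReal_zero] at h2
  simpa only [neg_div] using h2

end SelfStabilizing

end

theorem mainTheorem6 {Ω : Type*} [MeasurableSpace Ω] (P : Measure Ω) [IsProbabilityMeasure P]
    (a b t₀ t₁ a₀ K : ℝ) (ha : 0 < a) (hab : a < b) (hb : b < 1) (ht : t₀ < t₁) (hK : 0 < K)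
    (α : ℝ → ℝ) (hα : ContDiff ℝ 1 α) (hα_mem : ∀ ξ, α ξ ∈ Icc a b)
    (hα_deriv : ∃ C : ℝ, ∀ ξ, |deriv α ξ| ≤ C)
    (Pt : Ω → Set (ℝ × ℝ))
    (hPt_sub : ∀ ω, Pt ω ⊆ SelfStabilizing.outerStrip t₀ t₁ K)
    (hPt : SelfStabilizing.IsPoissonProcess P
      ((volume : Measure (ℝ × ℝ)).restrict (SelfStabilizing.outerStrip t₀ t₁ K)) Pt) :
    -- almost surely the equations for `Z` and for every `Z_n` have a unique solution
    (∀ᵐ ω ∂P, ∃ f, SelfStabilizing.IsJumpPath t₀ t₁ a₀ α (Pt ω) f ∧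
      ∀ g, SelfStabilizing.IsJumpPath t₀ t₁ a₀ α (Pt ω) g → EqOn g f (Ico t₀ t₁)) ∧
    (∀ n : ℕ, ∀ᵐ ω ∂P,
      ∃ f, SelfStabilizing.IsJumpPath t₀ t₁ a₀ α (SelfStabilizing.truncate (Pt ω) n) f ∧
        ∀ g, SelfStabilizing.IsJumpPath t₀ t₁ a₀ α (SelfStabilizing.truncate (Pt ω) n) g →
          EqOn g f (Ico t₀ t₁)) ∧
    -- the integral in the bound converges
    IntegrableOn (fun y => SelfStabilizing.absPowAB a b y) (Ioi K) ∧
    -- convergence in mean, with the rate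
    ∀ (Z : Ω → ℝ → ℝ) (Zn : ℕ → Ω → ℝ → ℝ),
      SelfStabilizing.IsJumpProcess P t₀ t₁ a₀ α Pt Z →
      (∀ n : ℕ, 1 ≤ n → SelfStabilizing.IsJumpProcess P t₀ t₁ a₀ α
        (fun ω => SelfStabilizing.truncate (Pt ω) n) (Zn n)) →
      (∀ n : ℕ, 1 ≤ n →
        AEMeasurable (fun ω => SelfStabilizing.supDist t₀ t₁ (Zn n ω) (Z ω)) P) ∧
      Tendsto (fun n : ℕ => ∫⁻ ω, SelfStabilizing.supDist t₀ t₁ (Zn n ω) (Z ω) ∂P) atTop (𝓝 0) ∧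
      ∀ n : ℕ, 1 ≤ n →
        ∫⁻ ω, SelfStabilizing.supDist t₀ t₁ (Zn n ω) (Z ω) ∂P ≤
          ENNReal.ofReal
            (2 * b * (t₁ - t₀) / (1 - b) *
              Real.exp (2 * SelfStabilizing.lipConst α * (t₁ - t₀) *
                ∫ y in Ioi K, SelfStabilizing.absPowAB a b y) *
              (n : ℝ) ^ (-(1 - b) / b)) := by
  have hsum := hPt.ae_summable ha hab hb ht hK
  have hsub : ∀ ω n, SelfStabilizing.truncate (Pt ω) n ⊆
      SelfStabilizing.outerStrip t₀ t₁ K :=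
    fun ω n => (SelfStabilizing.truncate_subset _ n).trans (hPt_sub ω)
  refine ⟨?_, fun n => ?_, SelfStabilizing.integrableOn_absPowAB ha hab hb hK,
    fun Z Zn hZ hZn => ?_⟩
  · filter_upwards [hsum] with ω hω
    obtain ⟨f, hf⟩ :=
      SelfStabilizing.exists_isJumpPath a₀ ha hK hα hα_mem hα_deriv (hPt_sub ω) hω
    exact ⟨f, hf, fun g hg => SelfStabilizing.eqOn_of_isJumpPath ha hK hα hα_mem hα_deriv
      (hPt_sub ω) hω hg hf⟩
  · filter_upwards [hsum] with ω hω
    have hωn := SelfStabilizing.summable_indicator_of_subset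
      (g := fun p : ℝ × ℝ => SelfStabilizing.absPowAB a b p.2)
      (fun p => SelfStabilizing.absPowAB_nonneg a b p.2) (fun p => le_rfl)
      (SelfStabilizing.truncate_subset (Pt ω) n) hω
    obtain ⟨f, hf⟩ :=
      SelfStabilizing.exists_isJumpPath a₀ ha hK hα hα_mem hα_deriv (hsub ω n) hωn
    exact ⟨f, hf, fun g hg => SelfStabilizing.eqOn_of_isJumpPath ha hK hα hα_mem hα_deriv
      (hsub ω n) hωn hg hf⟩
  · have hbound := fun (n : ℕ) (hn : 1 ≤ n) =>
      hPt.lintegral_supDist_le ha hab hb ht hK hα hα_mem hα_deriv hPt_sub hn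
        (hZn n hn).ae_isJumpPath hZ.ae_isJumpPath
    refine ⟨fun n hn => ?_, ?_, hbound⟩
    · exact SelfStabilizing.aemeasurable_supDist (hZn n hn).aemeasurable hZ.aemeasurable
        ((hZn n hn).ae_isJumpPath.mono fun ω h => h.1) (hZ.ae_isJumpPath.mono fun ω h => h.1)
    · refine tendsto_of_tendsto_of_tendsto_of_le_of_le' tendsto_const_nhds
        (SelfStabilizing.tendsto_ofReal_const_mul_rpow_neg (ha.trans hab) hb
          (2 * b * (t₁ - t₀) / (1 - b) * Real.exp (2 * SelfStabilizing.lipConst α * (t₁ - t₀) *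
            ∫ y in Ioi K, SelfStabilizing.absPowAB a b y)))
        (Eventually.of_forall fun n => zero_le) ?_
      filter_upwards [eventually_ge_atTop 1] with n hn using hbound n hn
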